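/- \textbf{Definitions.} All graphs and collections are finite. A \emph{circle graph} is an intersection graph of chords of a circle: vertices correspond to chords, and two distinct vertices are adjacent exactly when their chords intersect. An \emph{interval system} $\mathcal I$ is a finite collection of nonempty open intervals contained in $(0,1)$, no two of which share an endpoint. Two intervals \emph{overlap} if they intersect and neither contains the other; the \emph{overlap graph} of $\mathcal I$ has vertex set $\mathcal I$ and overlapping pairs as edges. The clique number of the overlap graph of a set $\mathcal S$ of intervals is denoted $\omega(\mathcal S)$. A \emph{pillar} of $\mathcal I$ is a point of $(0,1)$ that is not an endpoint of an interval of $\mathcal I$. Let $P$ be a finite set of pillars with a total order $\preceq$. An interval $I\in\mathcal I$ is \emph{assigned} to the $\preceq$-least pillar of $P$ that it contains, if there is one; $\mathcal I_p$ is the set of intervals assigned to $p$. The \emph{foundation} $F_p$ of $p\in P$ is the open interval containing $p$ with endpoints in $\{0,1\}\cup\{p'\in P: p'\prec p\}$ that contains no $p'\in P$ with $p'\prec p$. A partial colouring $\psi=\psi_{(P,\preceq)}$ of $\mathcal I$ is defined by treating the pillars in the order $\preceq$: when $p$ is treated, let $c_1<c_2<\cdots$ be the positive integers that are not colours, given at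 an earlier pillar, of an interval with exactly one endpoint in $F_p$; put $C_p=\{c_1,\dots,c_{\omega(\mathcal I_p)}\}$ and give each $I\in\mathcal I_p$ the colour $c_{h(I)}$, where $h(I)$ is the largest number of intervals $I_1,\dots,I_h=I$ in $\mathcal I_p$ whose left endpoints and whose right endpoints are both strictly increasing. The triple $(P,\preceq,\psi)$ is a \emph{pillar assignment} of $\mathcal I$. It is \emph{complete} if every interval of $\mathcal I$ contains a pillar of $P$, and $\chi(P,\preceq,\psi)=\left|\bigcup_{p\in P}C_p\right|$ is the number of colours it uses. An \emph{arch} is a nonempty open interval with endpoints in $\{0,1\}\cup P$ that contains no pillar of $P$; its \emph{degree} is the number of colours that $\psi$ gives to intervals of $\mathcal I$ with an endpoint in the arch. A pillar assignment $(P^*,\preceq^*,\psi^*)$ \emph{extends} $(P,\preceq,\psi)$ if $P\subseteq P^*$, the order $\preceq^*$ restricts to $\preceq$ on $P$, every pillar of $P$ precedes every pillar of $P^*\setminus P$ in $\preceq^*$, and $\psi^*$ is a proper partial colouring (overlapping intervals never receive the same colour) that extends $\psi$. \textbf{Theorem.} (a) For every integer $\omega\ge 2$, every circle graph with clique number at most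 $\omega$ has chromatic number at most \[ f(\omega)=2\omega\log_2\omega+2\omega\log_2\log_2\omega+10\omega, \] and (b) $f(\omega)=O(\omega\log\omega)$ as $\omega\to\infty$. (c) For every integer $\omega\ge2$ and every interval system $\mathcal I$ whose overlap graph has clique number at most $\omega$: if $(P,\preceq,\psi)$ is a pillar assignment of $\mathcal I$ with $\chi(P,\preceq,\psi)\le f(\omega)$, all of whose arches have degree at most $\omega\log_2\omega+\omega\log_2\log_2\omega+6\omega$, then there is a complete pillar assignment $(P^*,\preceq^*,\psi^*)$ of $\mathcal I$ that extends $(P,\preceq,\psi)$ and satisfies $\chi(P^*,\preceq^*,\psi^*)\le f(\omega)$. -/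

import Mathlib

open scoped Asymptotics

/-- A graph is a circle graph if it is the intersection graph of chords of a circle: each vertex `v`
corresponds to the chord joining two distinct points `a v`, `b v` of the unit circle, and two
distinct vertices are adjacent exactly when their chords intersect. -/
def IsCircleGraph {V : Type*} (G : SimpleGraph V) : Prop :=
  ∃ a b : V → Circle, (∀ v, a v ≠ b v) ∧
    ∀ u v, G.Adj u v ↔ u ≠ v ∧
      (segment ℝ (a u : ℂ) (b u : ℂ) ∩ segment ℝ (a v : ℂ) (b v : ℂ)).Nonempty

/-- The function `2ω log₂ ω + 2ω log₂ log₂ ω + 10ω`. -/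
noncomputable def colourBound (ω : ℕ) : ℝ :=
  2 * ω * Real.logb 2 ω + 2 * ω * Real.logb 2 (Real.logb 2 ω) + 10 * ω

/-- The function `ω log₂ ω + ω log₂ log₂ ω + 6ω`. -/
noncomputable def degreeBound (ω : ℕ) : ℝ :=
  ω * Real.logb 2 ω + ω * Real.logb 2 (Real.logb 2 ω) + 6 * ω

/-- The open interval `(I.1, I.2)` of real numbers coded by a pair of endpoints. -/
def openInterval (I : ℝ × ℝ) : Set ℝ := Set.Ioo I.1 I.2

/-- Two intervals overlap if they meet and neither is contained in the other. -/
def Overlap (I J : ℝ × ℝ) : Prop :=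
  (openInterval I ∩ openInterval J).Nonempty ∧
    ¬ openInterval I ⊆ openInterval J ∧ ¬ openInterval J ⊆ openInterval I

/-- The overlap graph of a finite set of intervals. -/
def overlapGraph (S : Finset (ℝ × ℝ)) : SimpleGraph S where
  Adj I J := Overlap I J
  symm := ⟨fun _ _ h => ⟨by rw [Set.inter_comm]; exact h.1, h.2.2, h.2.1⟩⟩
  loopless := ⟨fun _ h => h.2.1 Set.Subset.rfl⟩

/-- The strict order on intervals: both endpoints of `I` are to the left of those of `J`. -/
def StrictlyBefore (I J : ℝ × ℝ) : Prop := I.1 < J.1 ∧ I.2 < J.2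

open Classical in
/-- The height of `I` in `S`: the largest number of elements of a chain contained in `S` that
ends in `I`. -/
noncomputable def height (S : Finset (ℝ × ℝ)) (I : ℝ × ℝ) : ℕ :=
  (S.powerset.filter fun T : Finset (ℝ × ℝ) =>
    I ∈ T ∧ (∀ J ∈ T, J = I ∨ StrictlyBefore J I) ∧
      IsChain StrictlyBefore (T : Set (ℝ × ℝ))).sup Finset.card

/-- The `(k+1)`-st smallest positive integer that is not in `A`. -/
noncomputable def freeColour (A : Finset ℕ) (k : ℕ) : ℕ :=
  Nat.nth (fun c => 0 < c ∧ c ∉ A) k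

/-- The set of colours that the intervals in `S` receive from a partial colouring `ψ`
(`none` means uncoloured). -/
def receivedColours (ψ : ℝ × ℝ → Option ℕ) (S : Finset (ℝ × ℝ)) : Finset ℕ :=
  S.biUnion fun I => (ψ I).toFinset

/-- An interval system: a finite collection of nonempty open intervals contained in `(0,1)`, no two
of which share an endpoint. -/
structure IntervalSystem where
  intervals : Finset (ℝ × ℝ)
  mem_unit : ∀ I ∈ intervals, 0 ≤ I.1 ∧ I.1 < I.2 ∧ I.2 ≤ 1
  no_common_endpoint : ∀ I ∈ intervals, ∀ J ∈ intervals, I ≠ J →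
    I.1 ≠ J.1 ∧ I.1 ≠ J.2 ∧ I.2 ≠ J.1 ∧ I.2 ≠ J.2

namespace IntervalSystem

/-- A pillar is a point of `(0,1)` that is not an endpoint of an interval of the system. -/
def IsPillar (ℐ : IntervalSystem) (p : ℝ) : Prop :=
  p ∈ Set.Ioo (0 : ℝ) 1 ∧ ∀ I ∈ ℐ.intervals, p ≠ I.1 ∧ p ≠ I.2

open Classical in
/-- The intervals assigned to `p`, when `Q` is the list of all pillars preceding `p`: those that
contain `p` and no pillar of `Q`. -/
noncomputable def assigned (ℐ : IntervalSystem) (p : ℝ) (Q : List ℝ) : Finset (ℝ × ℝ) :=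
  ℐ.intervals.filter fun I => p ∈ openInterval I ∧ ∀ q ∈ Q, q ∉ openInterval I

/-- The foundation of `p`, when `Q` is the list of all pillars preceding `p`: the open interval
around `p` with endpoints in `Q ∪ {0, 1}` that contains no pillar of `Q`. -/
noncomputable def foundation (p : ℝ) (Q : List ℝ) : Set ℝ :=
  Set.Ioo
    ((insert 0 (Q.toFinset.filter fun q => q < p)).max' (Finset.insert_nonempty _ _))
    ((insert 1 (Q.toFinset.filter fun q => p < q)).min' (Finset.insert_nonempty _ _))

open Classical in
/-- The intervals with exactly one endpoint in the foundation of `p`. -/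
noncomputable def crossing (ℐ : IntervalSystem) (p : ℝ) (Q : List ℝ) : Finset (ℝ × ℝ) :=
  ℐ.intervals.filter fun I => Xor (I.1 ∈ foundation p Q) (I.2 ∈ foundation p Q)

open Classical in
/-- The partial colouring given by totally ordered pillars. The list names the pillars from the
last one to the first one, so in `p :: Q` the pillars in `Q` are those preceding `p`. An interval
assigned to `p` receives the colour `c_h`, where `h` is its height among the intervals assigned
to `p` and `c_1 < c_2 < ⋯` are the positive integers that are not received by any
interval with exactly one endpoint in the foundation of `p`. -/
noncomputable def colouring (ℐ : IntervalSystem) : List ℝ → ℝ × ℝ → Option ℕ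
  | [] => fun _ => none
  | p :: Q => fun I =>
      if I ∈ ℐ.assigned p Q then
        some (freeColour (receivedColours (ℐ.colouring Q) (ℐ.crossing p Q))
          (height (ℐ.assigned p Q) I - 1))
      else ℐ.colouring Q I

/-- The colour set `C_p`, when `Q` lists the pillars preceding `p`: the `m` smallest positive
integers that are not received by any interval with exactly one endpoint in the foundation
of `p`, where `m` is the clique number of the intervals assigned to `p`. -/
noncomputable def pillarColours (ℐ : IntervalSystem) (p : ℝ) (Q : List ℝ) : Finset ℕ :=
  (Finset.range (overlapGraph (ℐ.assigned p Q)).cliqueNum).image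
    (freeColour (receivedColours (ℐ.colouring Q) (ℐ.crossing p Q)))

/-- The union of the colour sets `C_p` over all pillars `p` (listed from last to first). -/
noncomputable def allColours (ℐ : IntervalSystem) : List ℝ → Finset ℕ
  | [] => ∅
  | p :: Q => ℐ.pillarColours p Q ∪ ℐ.allColours Q

/-- A proper partial colouring: overlapping intervals never receive the same colour. -/
def IsProperPartialColouring (ℐ : IntervalSystem) (ψ : ℝ × ℝ → Option ℕ) : Prop :=
  ∀ I ∈ ℐ.intervals, ∀ J ∈ ℐ.intervals, Overlap I J → ∀ c, ψ I = some c → ψ J ≠ some c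

end IntervalSystem

/-- A pillar assignment of `ℐ`: a finite totally ordered set of pillars, given as the
repetition-free list of its elements from the last one to the first one. Its colouring is
determined by this list, see `PillarAssignment.ψ`. -/
structure PillarAssignment (ℐ : IntervalSystem) where
  pillars : List ℝ
  nodup : pillars.Nodup
  isPillar : ∀ p ∈ pillars, ℐ.IsPillar p

namespace PillarAssignment

variable {ℐ : IntervalSystem}

/-- The partial colouring of a pillar assignment. -/
noncomputable def ψ (P : PillarAssignment ℐ) : ℝ × ℝ → Option ℕ := ℐ.colouring P.pillars

/-- The number of colours used by a pillar assignment. -/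
noncomputable def χ (P : PillarAssignment ℐ) : ℕ := (ℐ.allColours P.pillars).card

/-- A pillar assignment is complete if every interval contains one of its pillars. -/
def IsComplete (P : PillarAssignment ℐ) : Prop :=
  ∀ I ∈ ℐ.intervals, ∃ p ∈ P.pillars, p ∈ openInterval I

/-- `K` is an arch: a nonempty open interval with endpoints in `{0, 1} ∪ P` that contains no
pillar. -/
def IsArch (P : PillarAssignment ℐ) (K : ℝ × ℝ) : Prop :=
  K.1 < K.2 ∧ (K.1 = 0 ∨ K.1 = 1 ∨ K.1 ∈ P.pillars) ∧ (K.2 = 0 ∨ K.2 = 1 ∨ K.2 ∈ P.pillars) ∧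
    ∀ p ∈ P.pillars, p ∉ openInterval K

open Classical in
/-- The degree of `J`: the number of colours received by the intervals with an endpoint in `J`. -/
noncomputable def degree (P : PillarAssignment ℐ) (J : ℝ × ℝ) : ℕ :=
  (receivedColours P.ψ
    (ℐ.intervals.filter fun I => I.1 ∈ openInterval J ∨ I.2 ∈ openInterval J)).card

/-- `P'` extends `P`: the pillars of `P` are the first pillars of `P'`, in the same order, and the
colouring of `P'` is a proper partial colouring that extends that of `P`. -/
def Extends (P' P : PillarAssignment ℐ) : Prop :=
  P.pillars <:+ P'.pillars ∧ ℐ.IsProperPartialColouring P'.ψ ∧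
    ∀ I ∈ ℐ.intervals, ∀ c, P.ψ I = some c → P'.ψ I = some c

end PillarAssignment

/-!
Pillars are added to an assignment in such a way that every arch keeps degree at most `degreeBound`.
The colouring is proper whatever the pillars are: intervals assigned to the same pillar overlap
exactly when they are comparable, and then have different heights, while an interval coloured earlier
that overlaps an interval assigned to `p` has exactly one endpoint in the foundation of `p`, so that
its colour was avoided. The colours form an initial segment of the positive integers, hence a new
pillar inside an arch of degree `d` never needs a colour larger than `d + ω`.

The point is thus to keep degrees small while adding pillars inside an arch. The arch is cut greedily
into windows in each of which `t` old colours are seen. The key fact is that there are few windows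
(`IntervalSystem.card_mul_le_of_windows`). Inside an arch an old colour is the same thing as a pillar
together with a height; order these pairs lexicographically. A choice of right (or of left)
endpoints, one per window, along which the pairs increase can be exchanged for equally many pairwise
overlapping intervals, working from the last window backwards: if the interval chosen in one window is
not strictly before its successor `J`, both belong to the same pillar, and the interval of the
required height in a chain that witnesses the height of `J` has its endpoint further to the
right and can replace it (`exists_strictlyBefore_of_height_lt`, `exists_pairwise_strictlyBefore`). So such a choice has
length at most `ω`, and a set of points of a grid without strict chains of more than `ω` points is a
union of `ω` staircases (`card_le_of_forall_pairwise_length_le`). It follows that `m` windows satisfy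
`m * t ≤ ω * (2 * m + degree)`, which bounds `m` by about `ω * logb 2 ω`.

If there are fewer than `2 ^ n` cuts, treating them in the order of a binary search ensures that each
new arch receives at most `n * ω` new colours besides its at most `t` old ones
(`IntervalSystem.exists_list_of_card_lt_two_pow`). The constants are such that
`t + n * ω ≤ degreeBound ω` and `degreeBound ω + n * ω ≤ colourBound ω` (`exists_parameters`).
Iterating until no interval is left without a pillar gives the extension
(`PillarAssignment.exists_complete`).

For circle graphs, the chords are read as intervals of arguments of their endpoints; two chords
intersect exactly when these intervals interleave weakly. Coinciding endpoints are separated so that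
weak interleaving becomes overlapping, and the extension theorem is applied to the empty assignment.
-/

/-! ### Cliques, chains and heights -/

theorem SimpleGraph.cliqueNum_le_of_injective {V W : Type*} [Finite W] {G : SimpleGraph V}
    {H : SimpleGraph W} (f : V → W) (hf : Function.Injective f)
    (hadj : ∀ u v, G.Adj u v → H.Adj (f u) (f v)) : G.cliqueNum ≤ H.cliqueNum := by
  obtain ⟨s, hs⟩ := G.exists_isNClique_cliqueNum
  have hc : H.IsClique (s.map ⟨f, hf⟩ : Finset W) := by
    intro x hx y hy hxy
    simp only [Finset.coe_map, Set.mem_image, Finset.mem_coe, Function.Embedding.coeFn_mk] at hx hy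
    obtain ⟨u, hu, rfl⟩ := hx
    obtain ⟨v, hv, rfl⟩ := hy
    exact hadj u v (hs.isClique hu hv fun h => hxy (by rw [h]))
  have := hc.card_le_cliqueNum
  rwa [Finset.card_map, hs.card_eq] at this

theorem StrictlyBefore.trans {I J K : ℝ × ℝ} (h : StrictlyBefore I J) (h' : StrictlyBefore J K) :
    StrictlyBefore I K :=
  ⟨h.1.trans h'.1, h.2.trans h'.2⟩

theorem StrictlyBefore.overlap {I J : ℝ × ℝ} {z : ℝ} (h : StrictlyBefore I J)
    (hI : z ∈ openInterval I) (hJ : z ∈ openInterval J) : Overlap I J := by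
  have hI1 := hI.1
  have hI2 := hI.2
  have hJ1 := hJ.1
  have hJ2 := hJ.2
  have h1 := h.1
  have h2 := h.2
  refine ⟨⟨z, hI, hJ⟩, fun hs => ?_, fun hs => ?_⟩
  · have := (hs (show J.1 ∈ openInterval I from ⟨h1, by linarith⟩)).1
    exact lt_irrefl _ this
  · have := (hs (show I.2 ∈ openInterval J from ⟨by linarith, h2⟩)).2
    exact lt_irrefl _ this

theorem Overlap.symm {I J : ℝ × ℝ} (h : Overlap I J) : Overlap J I :=
  ⟨by rw [Set.inter_comm]; exact h.1, h.2.2, h.2.1⟩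

theorem Overlap.strictlyBefore_or {I J : ℝ × ℝ} (h : Overlap I J) :
    StrictlyBefore I J ∨ StrictlyBefore J I := by
  have h1 : ¬ (J.1 ≤ I.1 ∧ I.2 ≤ J.2) := fun h' => h.2.1 (Set.Ioo_subset_Ioo h'.1 h'.2)
  have h2 : ¬ (I.1 ≤ J.1 ∧ J.2 ≤ I.2) := fun h' => h.2.2 (Set.Ioo_subset_Ioo h'.1 h'.2)
  unfold StrictlyBefore
  by_contra! hc
  rcases lt_trichotomy I.1 J.1 with hlt | heq | hgt
  · exact h2 ⟨hlt.le, hc.1 hlt⟩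
  · rcases le_total I.2 J.2 with hle | hle
    · exact h1 ⟨heq.ge, hle⟩
    · exact h2 ⟨heq.le, hle⟩
  · exact h1 ⟨hgt.le, hc.2 hgt⟩

theorem overlapGraph_cliqueNum_mono {S T : Finset (ℝ × ℝ)} (h : S ⊆ T) :
    (overlapGraph S).cliqueNum ≤ (overlapGraph T).cliqueNum :=
  SimpleGraph.cliqueNum_le_of_injective (fun I => ⟨I.1, h I.2⟩)
    (fun _ _ h => Subtype.ext (Subtype.mk.inj h)) fun _ _ h => h

/-- Intervals through a common point that form a chain pairwise overlap. -/
theorem card_le_cliqueNum_of_isChain {S T : Finset (ℝ × ℝ)} (hTS : T ⊆ S)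
    (hT : IsChain StrictlyBefore (T : Set (ℝ × ℝ))) {z : ℝ} (hz : ∀ I ∈ T, z ∈ openInterval I) :
    T.card ≤ (overlapGraph S).cliqueNum := by
  have hc : (overlapGraph S).IsClique (T.subtype (· ∈ S) : Finset S) := by
    intro I hI J hJ hIJ
    simp only [Finset.mem_coe, Finset.mem_subtype] at hI hJ
    rcases hT hI hJ (fun h => hIJ (Subtype.ext h)) with h | h
    · exact h.overlap (hz _ hI) (hz _ hJ)
    · exact (h.overlap (hz _ hJ) (hz _ hI)).symm
  have := hc.card_le_cliqueNum
  rwa [Finset.card_subtype, Finset.filter_true_of_mem fun I hI => hTS hI] at this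

theorem exists_chain_card_eq_height {S : Finset (ℝ × ℝ)} {I : ℝ × ℝ} (hI : I ∈ S) :
    ∃ T ⊆ S, I ∈ T ∧ (∀ J ∈ T, J = I ∨ StrictlyBefore J I) ∧
      IsChain StrictlyBefore (T : Set (ℝ × ℝ)) ∧ T.card = height S I := by
  classical
  obtain ⟨T, hT, h⟩ := Finset.exists_mem_eq_sup (S.powerset.filter fun T : Finset (ℝ × ℝ) =>
    I ∈ T ∧ (∀ J ∈ T, J = I ∨ StrictlyBefore J I) ∧
      IsChain StrictlyBefore (T : Set (ℝ × ℝ)))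
    ⟨{I}, by
      simp only [Finset.mem_filter, Finset.mem_powerset, Finset.singleton_subset_iff,
        Finset.mem_singleton, Finset.coe_singleton]
      exact ⟨hI, trivial, fun J hJ => Or.inl hJ, Set.pairwise_singleton _ _⟩⟩ Finset.card
  simp only [Finset.mem_filter, Finset.mem_powerset] at hT
  exact ⟨T, hT.1, hT.2.1, hT.2.2.1, hT.2.2.2, h.symm⟩

theorem card_le_height {S T : Finset (ℝ × ℝ)} {I : ℝ × ℝ} (hTS : T ⊆ S) (hI : I ∈ T)
    (h : ∀ J ∈ T, J = I ∨ StrictlyBefore J I) (hT : IsChain StrictlyBefore (T : Set (ℝ × ℝ))) :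
    T.card ≤ height S I := by
  classical
  unfold height
  apply Finset.le_sup (f := Finset.card)
  simp only [Finset.mem_filter, Finset.mem_powerset]
  exact ⟨hTS, hI, h, hT⟩

theorem height_pos {S : Finset (ℝ × ℝ)} {I : ℝ × ℝ} (hI : I ∈ S) : 0 < height S I := by
  obtain ⟨T, -, hIT, -, -, h⟩ := exists_chain_card_eq_height hI
  rw [← h]
  exact Finset.card_pos.2 ⟨I, hIT⟩

theorem height_lt_height {S : Finset (ℝ × ℝ)} {I J : ℝ × ℝ} (hI : I ∈ S) (hJ : J ∈ S)
    (h : StrictlyBefore I J) : height S I < height S J := by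
  classical
  obtain ⟨T, hTS, hIT, hlast, hT, hcard⟩ := exists_chain_card_eq_height hI
  have hbefore : ∀ K ∈ T, StrictlyBefore K J := fun K hK => by
    rcases hlast K hK with rfl | hKI
    · exact h
    · exact hKI.trans h
  have hJT : J ∉ T := fun hJT => lt_irrefl _ (hbefore J hJT).1
  have := card_le_height (S := S) (T := insert J T) (I := J)
    (Finset.insert_subset hJ hTS) (Finset.mem_insert_self _ _)
    (fun K hK => (Finset.mem_insert.1 hK).imp_right (hbefore K)) (by
      rw [Finset.coe_insert]
      exact hT.insert fun K hK _ => Or.inr (hbefore K hK))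
  rw [Finset.card_insert_of_notMem hJT, hcard] at this
  omega

/-- Along a longest chain ending in `J` the height takes every value from `1` to that of `J`. -/
theorem exists_strictlyBefore_height_eq {S : Finset (ℝ × ℝ)} {J : ℝ × ℝ} {k : ℕ} (hJ : J ∈ S)
    (hk : 0 < k) (hkJ : k < height S J) : ∃ I ∈ S, StrictlyBefore I J ∧ height S I = k := by
  obtain ⟨T, hTS, hJT, hlast, hT, hcard⟩ := exists_chain_card_eq_height hJ
  have hinj : Set.InjOn (height S) (T : Set (ℝ × ℝ)) := fun A hA B hB hAB => by
    by_contra hne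
    rcases hT hA hB hne with h | h
    · exact (height_lt_height (hTS hA) (hTS hB) h).ne hAB
    · exact (height_lt_height (hTS hB) (hTS hA) h).ne' hAB
  have himage : T.image (height S) = Finset.Icc 1 (height S J) := by
    apply Finset.eq_of_subset_of_card_le
    · intro m hm
      obtain ⟨A, hA, rfl⟩ := Finset.mem_image.1 hm
      refine Finset.mem_Icc.2 ⟨height_pos (hTS hA), ?_⟩
      rcases hlast A hA with rfl | h
      · exact le_rfl
      · exact (height_lt_height (hTS hA) hJ h).le
    · rw [Finset.card_image_of_injOn hinj, hcard, Nat.card_Icc]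
      omega
  have hmem : k ∈ T.image (height S) := by
    rw [himage]
    exact Finset.mem_Icc.2 ⟨hk, hkJ.le⟩
  obtain ⟨I, hI, rfl⟩ := Finset.mem_image.1 hmem
  refine ⟨I, hTS hI, ?_, rfl⟩
  rcases hlast I hI with rfl | h
  · exact absurd hkJ (lt_irrefl _)
  · exact h

/-- The exchange step. Here `y` is one of the two endpoints and `x` the other one. If `I` has smaller
height than `J` and comes earlier in the coordinate `y`, then `J` has a strict predecessor of the
height of `I` that is not earlier than `I` in the coordinate `y`. For if the interval `K` of that
height in a chain ending in `J` is earlier than `I`, then `I` itself is strictly before `J`: otherwise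
`K` would be strictly before `I`, and their heights would differ. -/
theorem exists_strictlyBefore_of_height_lt {S : Finset (ℝ × ℝ)} {I J : ℝ × ℝ} (hI : I ∈ S)
    (hJ : J ∈ S) (h : height S I < height S J) {x y : ℝ × ℝ → ℝ}
    (hxy : ∀ A B, StrictlyBefore A B ↔ x A < x B ∧ y A < y B) (hy : y I < y J) :
    ∃ K ∈ S, height S K = height S I ∧ y I ≤ y K ∧ StrictlyBefore K J := by
  obtain ⟨K, hK, hKJ, hKh⟩ := exists_strictlyBefore_height_eq hJ (height_pos hI) h
  rcases le_or_gt (y I) (y K) with hle | hlt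
  · exact ⟨K, hK, hKh, hle, hKJ⟩
  · refine ⟨I, hI, rfl, le_rfl, (hxy _ _).2 ⟨?_, hy⟩⟩
    by_contra! hx
    exact (height_lt_height hK hI
      ((hxy _ _).2 ⟨((hxy _ _).1 hKJ).1.trans_le hx, hlt⟩)).ne hKh

/-! ### Sets without long chains in a product of two linear orders -/

/-- The elements minimal for the strict product order form a staircase, hence are at most
`|X| + |K|` in number; removing them shortens all chains. -/
theorem card_le_of_forall_pairwise_length_le {α β : Type*} [LinearOrder α] [LinearOrder β]
    (X : Finset α) (K : Finset β) (n : ℕ) (T : Finset (α × β)) (hT : T ⊆ X ×ˢ K)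
    (h : ∀ l : List (α × β), l.Pairwise (fun s t => s.1 < t.1 ∧ s.2 < t.2) →
      (∀ s ∈ l, s ∈ T) → l.length ≤ n) :
    T.card ≤ n * (X.card + K.card) := by
  classical
  induction n generalizing T with
  | zero =>
    rw [Finset.card_eq_zero.2, Nat.zero_mul]
    by_contra hne
    obtain ⟨s, hs⟩ := Finset.nonempty_of_ne_empty hne
    have := h [s] (by simp) (by simpa using hs)
    simp at this
  | succ n ih =>
    let low := T.filter fun t => ¬ ∃ s ∈ T, s.1 < t.1 ∧ s.2 < t.2
    let high := T.filter fun t => ∃ s ∈ T, s.1 < t.1 ∧ s.2 < t.2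
    have hsplit : high.card + low.card = T.card :=
      Finset.card_filter_add_card_filter_not _
    have hhigh : high.card ≤ n * (X.card + K.card) := by
      refine ih high ((Finset.filter_subset _ _).trans hT) fun l hl hlT => ?_
      rcases l with _ | ⟨t, l⟩
      · simp
      · obtain ⟨-, s, hs, hst⟩ := Finset.mem_filter.1 (hlT t (by simp))
        have := h (s :: t :: l) (List.pairwise_cons.2 ⟨fun u hu => ?_, hl⟩) fun u hu => ?_
        · simpa using this
        · rcases List.mem_cons.1 hu with rfl | hu
          · exact hst
          · have := (List.pairwise_cons.1 hl).1 u hu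
            exact ⟨hst.1.trans this.1, hst.2.trans this.2⟩
        · rcases List.mem_cons.1 hu with rfl | hu
          · exact hs
          · exact (Finset.mem_filter.1 (hlT u hu)).1
    have hlow : low.card ≤ X.card + K.card := by
      -- Along a weakly decreasing staircase this rank is strictly monotone.
      let rank : α × β → ℕ := fun t =>
        (X.filter (t.1 < ·)).card + (K.filter (· < t.2)).card
      have hrank : ∀ s t : α × β, s ∈ X ×ˢ K → s.1 ≤ t.1 → t.2 ≤ s.2 →
          t ∈ X ×ˢ K → s ≠ t → rank t < rank s := by
        intro s t hs h1 h2 ht hne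
        rw [Finset.mem_product] at hs ht
        have hX : (X.filter (t.1 < ·)).card ≤ (X.filter (s.1 < ·)).card :=
          Finset.card_le_card fun a ha => by
            simp only [Finset.mem_filter] at ha ⊢
            exact ⟨ha.1, h1.trans_lt ha.2⟩
        have hK : (K.filter (· < t.2)).card ≤ (K.filter (· < s.2)).card :=
          Finset.card_le_card fun a ha => by
            simp only [Finset.mem_filter] at ha ⊢
            exact ⟨ha.1, ha.2.trans_le h2⟩
        rcases h1.lt_or_eq with h1' | h1'
        · have : (X.filter (t.1 < ·)).card < (X.filter (s.1 < ·)).card := by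
            refine Finset.card_lt_card ⟨fun a ha => ?_, fun hsub => ?_⟩
            · simp only [Finset.mem_filter] at ha ⊢
              exact ⟨ha.1, h1.trans_lt ha.2⟩
            · have := hsub (Finset.mem_filter.2 ⟨ht.1, h1'⟩)
              simp at this
          simp only [rank]
          omega
        · have h2' : t.2 < s.2 := lt_of_le_of_ne h2 fun h => hne (Prod.ext h1' h.symm)
          have : (K.filter (· < t.2)).card < (K.filter (· < s.2)).card := by
            refine Finset.card_lt_card ⟨fun a ha => ?_, fun hsub => ?_⟩
            · simp only [Finset.mem_filter] at ha ⊢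
              exact ⟨ha.1, ha.2.trans_le h2⟩
            · have := hsub (Finset.mem_filter.2 ⟨ht.2, h2'⟩)
              simp at this
          simp only [rank]
          omega
      have hinj : Set.InjOn rank (low : Set (α × β)) := by
        intro s hs t ht hst
        by_contra hne
        obtain ⟨hsT, hs'⟩ := Finset.mem_filter.1 hs
        obtain ⟨htT, ht'⟩ := Finset.mem_filter.1 ht
        push Not at hs' ht'
        rcases lt_trichotomy s.1 t.1 with h1 | h1 | h1
        · exact (hrank s t (hT hsT) h1.le (ht' s hsT h1) (hT htT) hne).ne hst.symm
        · rcases le_total t.2 s.2 with h2 | h2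
          · exact (hrank s t (hT hsT) h1.le h2 (hT htT) hne).ne hst.symm
          · exact (hrank t s (hT htT) h1.ge h2 (hT hsT) (Ne.symm hne)).ne hst
        · exact (hrank t s (hT htT) h1.le (hs' t htT h1) (hT hsT) (Ne.symm hne)).ne hst
      have hmaps : ∀ t ∈ low, rank t ∈ Finset.range (X.card + K.card) := by
        intro t ht
        have htXK := Finset.mem_product.1 (hT (Finset.mem_filter.1 ht).1)
        have h1 : (X.filter (t.1 < ·)).card < X.card :=
          Finset.card_lt_card ⟨Finset.filter_subset _ _, fun hsub => by
            simpa using hsub htXK.1⟩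
        have h2 : (K.filter (· < t.2)).card ≤ K.card := Finset.card_filter_le _ _
        rw [Finset.mem_range]
        simp only [rank]
        omega
      simpa using Finset.card_le_card_of_injOn rank hmaps hinj
    rw [← hsplit, Nat.succ_mul]
    omega

/-- Working from the last element of `l` to the first, each element is replaced by one with the same
key that is strictly before the replacement of its successor. -/
theorem exists_pairwise_strictlyBefore {κ : Type*} [LinearOrder κ] (X : Set (ℝ × ℝ))
    (key : ℝ × ℝ → κ) (y : ℝ × ℝ → ℝ)
    (hX : ∀ I ∈ X, ∀ J ∈ X, key I < key J → y I < y J →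
      ∃ K ∈ X, key K = key I ∧ y I ≤ y K ∧ StrictlyBefore K J)
    (l : List (ℝ × ℝ)) (I : ℝ × ℝ)
    (hl : (I :: l).Pairwise fun A B => key A < key B ∧ y A < y B) (hmem : ∀ A ∈ I :: l, A ∈ X) :
    ∃ I' l', l'.length = l.length ∧ (I' :: l').Pairwise StrictlyBefore ∧ (∀ A ∈ I' :: l', A ∈ X) ∧
      key I' = key I ∧ y I ≤ y I' := by
  induction l generalizing I with
  | nil => exact ⟨I, [], rfl, by simp, by simpa using hmem, rfl, le_rfl⟩
  | cons J l ih =>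
    rw [List.pairwise_cons] at hl
    obtain ⟨J', l', hlen, hl', hX', hkey, hy⟩ := ih J hl.2 fun A hA => hmem A (by simp_all)
    have hIJ := hl.1 J (by simp)
    obtain ⟨K, hK, hKI, hIK, hKJ⟩ := hX I (hmem I (by simp)) J' (hX' J' (by simp))
      (hkey ▸ hIJ.1) (hIJ.2.trans_le hy)
    refine ⟨K, J' :: l', by simp [hlen], List.pairwise_cons.2 ⟨fun A hA => ?_, hl'⟩,
      fun A hA => ?_, hKI, hIK⟩
    · rcases List.mem_cons.1 hA with rfl | hA
      · exact hKJ
      · exact hKJ.trans ((List.pairwise_cons.1 hl').1 A hA)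
    · rcases List.mem_cons.1 hA with rfl | hA
      · exact hK
      · exact hX' A hA

theorem length_le_cliqueNum_of_pairwise {S : Finset (ℝ × ℝ)} {l : List (ℝ × ℝ)}
    (hl : l.Pairwise StrictlyBefore) (hS : ∀ I ∈ l, I ∈ S) {z : ℝ}
    (hz : ∀ I ∈ l, z ∈ openInterval I) : l.length ≤ (overlapGraph S).cliqueNum := by
  classical
  have hnodup : l.Nodup := hl.imp fun h heq => by
    subst heq
    exact lt_irrefl _ h.1
  rw [← List.toFinset_card_of_nodup hnodup]
  refine card_le_cliqueNum_of_isChain (fun I hI => hS I (List.mem_toFinset.1 hI)) ?_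
    fun I hI => hz I (List.mem_toFinset.1 hI)
  intro A hA B hB hAB
  have hsymm : Std.Symm fun A B => StrictlyBefore A B ∨ StrictlyBefore B A := ⟨fun _ _ => Or.symm⟩
  exact (hl.imp (S := fun A B => StrictlyBefore A B ∨ StrictlyBefore B A) Or.inl).forall
    (by simpa using hA) (by simpa using hB) hAB

/-! ### Free colours -/

theorem infinite_setOf_pos_notMem (A : Finset ℕ) :
    (Set.ofPred fun c => 0 < c ∧ c ∉ A).Infinite := by
  refine Set.infinite_of_forall_exists_gt fun n => ⟨A.sup id + n + 1, ⟨by omega, fun h => ?_⟩,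
    by omega⟩
  have := Finset.le_sup (f := id) h
  simp only [id] at this
  omega

theorem freeColour_pos (A : Finset ℕ) (k : ℕ) : 0 < freeColour A k :=
  (Nat.nth_mem_of_infinite (infinite_setOf_pos_notMem A) k).1

theorem freeColour_notMem (A : Finset ℕ) (k : ℕ) : freeColour A k ∉ A :=
  (Nat.nth_mem_of_infinite (infinite_setOf_pos_notMem A) k).2

theorem freeColour_injective (A : Finset ℕ) : Function.Injective (freeColour A) :=
  Nat.nth_injective (infinite_setOf_pos_notMem A)

theorem freeColour_le (A : Finset ℕ) (k : ℕ) : freeColour A k ≤ A.card + k + 1 := by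
  classical
  have h : k < Nat.count (fun c => 0 < c ∧ c ∉ A) (A.card + k + 2) := by
    rw [Nat.count_eq_card_filter_range]
    have hsub : Finset.range (A.card + k + 2) ⊆
        (Finset.range (A.card + k + 2)).filter (fun c => 0 < c ∧ c ∉ A) ∪ insert 0 A := by
      intro c hc
      by_cases h0 : c = 0 <;> by_cases hA : c ∈ A <;> simp_all [Nat.pos_iff_ne_zero]
    have h1 := Finset.card_le_card hsub
    have h2 := Finset.card_union_le
      ((Finset.range (A.card + k + 2)).filter (fun c => 0 < c ∧ c ∉ A)) (insert 0 A)
    have h3 := Finset.card_insert_le 0 A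
    rw [Finset.card_range] at h1
    omega
  exact Nat.le_of_lt_succ (Nat.nth_lt_of_lt_count h)

theorem exists_freeColour_eq {A : Finset ℕ} {k c : ℕ} (hc : c < freeColour A k) (h0 : 0 < c)
    (hA : c ∉ A) : ∃ j < k, freeColour A j = c := by
  classical
  have hnth : Nat.nth (fun c => 0 < c ∧ c ∉ A) (Nat.count (fun c => 0 < c ∧ c ∉ A) c) = c :=
    Nat.nth_count (p := fun c => 0 < c ∧ c ∉ A) ⟨h0, hA⟩
  refine ⟨_, ?_, hnth⟩
  by_contra! h
  have := (Nat.nth_strictMono (infinite_setOf_pos_notMem A)).monotone h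
  rw [hnth] at this
  exact absurd hc (not_lt.2 this)

theorem Finset.eq_Icc_one_card {s : Finset ℕ} (h0 : 0 ∉ s)
    (h : ∀ c ∈ s, ∀ d, 0 < d → d < c → d ∈ s) : s = Finset.Icc 1 s.card := by
  rcases s.eq_empty_or_nonempty with rfl | hs
  · simp
  have hs' : s = Finset.Icc 1 (s.max' hs) := by
    ext d
    rw [Finset.mem_Icc]
    refine ⟨fun hd => ⟨Nat.pos_of_ne_zero fun h => h0 (h ▸ hd), s.le_max' _ hd⟩, fun hd => ?_⟩
    rcases hd.2.lt_or_eq with hlt | heq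
    · exact h _ (s.max'_mem hs) d hd.1 hlt
    · exact heq ▸ s.max'_mem hs
  conv_lhs => rw [hs']
  congr 1
  conv_rhs => rw [hs']
  simp

namespace IntervalSystem

variable (ℐ : IntervalSystem)

/-! ### The colouring of a list of pillars -/

theorem mem_assigned {p : ℝ} {Q : List ℝ} {I : ℝ × ℝ} : I ∈ ℐ.assigned p Q ↔
    I ∈ ℐ.intervals ∧ p ∈ openInterval I ∧ ∀ q ∈ Q, q ∉ openInterval I := by
  simp [assigned]

theorem assigned_subset (p : ℝ) (Q : List ℝ) : ℐ.assigned p Q ⊆ ℐ.intervals :=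
  fun _ hI => (ℐ.mem_assigned.1 hI).1

theorem height_le_cliqueNum {p : ℝ} {Q : List ℝ} {I : ℝ × ℝ} (hI : I ∈ ℐ.assigned p Q) :
    height (ℐ.assigned p Q) I ≤ (overlapGraph (ℐ.assigned p Q)).cliqueNum := by
  obtain ⟨T, hT, -, -, hchain, hcard⟩ := exists_chain_card_eq_height hI
  rw [← hcard]
  exact card_le_cliqueNum_of_isChain hT hchain fun J hJ => (ℐ.mem_assigned.1 (hT hJ)).2.1

/-- The intervals assigned to `p` when the pillars of `R` precede it, for the suffix `p :: R` of the
list, are those for which `p` is the first pillar that they contain. -/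
theorem exists_suffix_mem_assigned {Q : List ℝ} {I : ℝ × ℝ} (hI : I ∈ ℐ.intervals)
    (h : ∃ q ∈ Q, q ∈ openInterval I) : ∃ p R, p :: R <:+ Q ∧ I ∈ ℐ.assigned p R := by
  induction Q with
  | nil => simp at h
  | cons x Q ih =>
    by_cases hQ : ∃ q ∈ Q, q ∈ openInterval I
    · obtain ⟨p, R, hR, hp⟩ := ih hQ
      exact ⟨p, R, hR.trans (List.suffix_cons _ _), hp⟩
    · push Not at hQ
      obtain ⟨q, hq, hqI⟩ := h
      rcases List.mem_cons.1 hq with rfl | hq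
      · exact ⟨q, Q, List.suffix_rfl, ℐ.mem_assigned.2 ⟨hI, hqI, hQ⟩⟩
      · exact absurd hqI (hQ q hq)

theorem notMem_of_mem_assigned {p : ℝ} {R : List ℝ} {I : ℝ × ℝ} (hI : I ∈ ℐ.assigned p R) :
    p ∉ R :=
  fun h => (ℐ.mem_assigned.1 hI).2.2 p h (ℐ.mem_assigned.1 hI).2.1

theorem suffix_trichotomy {Q R S : List ℝ} {p q : ℝ} (hp : p :: R <:+ Q) (hq : q :: S <:+ Q) :
    (p = q ∧ R = S) ∨ p :: R <:+ S ∨ q :: S <:+ R := by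
  rcases List.suffix_or_suffix_of_suffix hp hq with h | h
  · rcases List.suffix_cons_iff.1 h with h | h
    · exact Or.inl (List.cons.inj h)
    · exact Or.inr (Or.inl h)
  · rcases List.suffix_cons_iff.1 h with h | h
    · exact Or.inl ⟨(List.cons.inj h).1.symm, (List.cons.inj h).2.symm⟩
    · exact Or.inr (Or.inr h)

theorem colouring_cons_of_mem {x : ℝ} {Q : List ℝ} {I : ℝ × ℝ} (hI : I ∈ ℐ.assigned x Q) :
    ℐ.colouring (x :: Q) I = some (freeColour (receivedColours (ℐ.colouring Q) (ℐ.crossing x Q))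
      (height (ℐ.assigned x Q) I - 1)) :=
  if_pos hI

theorem colouring_cons_of_notMem {x : ℝ} {Q : List ℝ} {I : ℝ × ℝ} (hI : I ∉ ℐ.assigned x Q) :
    ℐ.colouring (x :: Q) I = ℐ.colouring Q I :=
  if_neg hI

theorem colouring_of_suffix {Q R : List ℝ} {p : ℝ} {I : ℝ × ℝ} (hR : p :: R <:+ Q)
    (hI : I ∈ ℐ.assigned p R) : ℐ.colouring Q I =
      some (freeColour (receivedColours (ℐ.colouring R) (ℐ.crossing p R))
        (height (ℐ.assigned p R) I - 1)) := by
  induction Q with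
  | nil => simp at hR
  | cons x Q ih =>
    rcases List.suffix_cons_iff.1 hR with h | h
    · obtain ⟨rfl, rfl⟩ := List.cons.inj h
      exact ℐ.colouring_cons_of_mem hI
    · rw [ℐ.colouring_cons_of_notMem, ih h]
      intro hx
      exact (ℐ.mem_assigned.1 hx).2.2 p (h.subset (by simp)) (ℐ.mem_assigned.1 hI).2.1

theorem exists_mem_of_colouring_eq_some {Q : List ℝ} {I : ℝ × ℝ} {c : ℕ}
    (h : ℐ.colouring Q I = some c) : I ∈ ℐ.intervals ∧ ∃ q ∈ Q, q ∈ openInterval I := by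
  induction Q with
  | nil => simp [colouring] at h
  | cons x Q ih =>
    by_cases hx : I ∈ ℐ.assigned x Q
    · exact ⟨(ℐ.mem_assigned.1 hx).1, x, by simp, (ℐ.mem_assigned.1 hx).2.1⟩
    · rw [ℐ.colouring_cons_of_notMem hx] at h
      obtain ⟨hI, q, hq, hqI⟩ := ih h
      exact ⟨hI, q, by simp [hq], hqI⟩

theorem colouring_eq_some_of_suffix {Q R : List ℝ} {I : ℝ × ℝ} {c : ℕ} (hR : R <:+ Q)
    (h : ℐ.colouring R I = some c) : ℐ.colouring Q I = some c := by
  obtain ⟨hI, hex⟩ := ℐ.exists_mem_of_colouring_eq_some h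
  obtain ⟨p, S, hS, hp⟩ := ℐ.exists_suffix_mem_assigned hI hex
  rw [← h, ℐ.colouring_of_suffix hS hp, ℐ.colouring_of_suffix (hS.trans hR) hp]

theorem mem_receivedColours {ψ : ℝ × ℝ → Option ℕ} {S : Finset (ℝ × ℝ)} {c : ℕ} :
    c ∈ receivedColours ψ S ↔ ∃ I ∈ S, ψ I = some c := by
  simp [receivedColours]

theorem mem_allColours_of_colouring {Q : List ℝ} {I : ℝ × ℝ} {c : ℕ}
    (h : ℐ.colouring Q I = some c) : c ∈ ℐ.allColours Q := by
  induction Q with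
  | nil => simp [colouring] at h
  | cons x Q ih =>
    rw [allColours, Finset.mem_union]
    by_cases hx : I ∈ ℐ.assigned x Q
    · left
      rw [ℐ.colouring_cons_of_mem hx] at h
      rw [pillarColours, ← Option.some.inj h]
      refine Finset.mem_image_of_mem _ (Finset.mem_range.2 ?_)
      have h1 := ℐ.height_le_cliqueNum hx
      have h2 := height_pos hx
      omega
    · rw [ℐ.colouring_cons_of_notMem hx] at h
      exact Or.inr (ih h)

/-- The colours used form an initial segment of the positive integers, so that bounding their number
amounts to bounding the largest of them. -/
theorem allColours_eq_Icc (Q : List ℝ) :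
    ℐ.allColours Q = Finset.Icc 1 (ℐ.allColours Q).card := by
  apply Finset.eq_Icc_one_card
  · induction Q with
    | nil => simp [allColours]
    | cons x Q ih =>
      rw [allColours, Finset.mem_union, pillarColours, Finset.mem_image]
      rintro (⟨k, -, hk⟩ | h)
      · exact (freeColour_pos _ k).ne' hk
      · exact ih h
  · induction Q with
    | nil => simp [allColours]
    | cons x Q ih =>
      intro c hc d hd hdc
      rw [allColours, Finset.mem_union] at hc ⊢
      rcases hc with hc | hc
      · rw [pillarColours, Finset.mem_image] at hc
        obtain ⟨k, hk, rfl⟩ := hc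
        by_cases hdA : d ∈ receivedColours (ℐ.colouring Q) (ℐ.crossing x Q)
        · obtain ⟨I, -, hI⟩ := mem_receivedColours.1 hdA
          exact Or.inr (ℐ.mem_allColours_of_colouring hI)
        · obtain ⟨j, hj, rfl⟩ := exists_freeColour_eq hdc hd hdA
          exact Or.inl (Finset.mem_image_of_mem _
            (Finset.mem_range.2 (hj.trans (Finset.mem_range.1 hk))))
      · exact Or.inr (ih c hc d hd hdc)

theorem card_allColours_cons_le {x : ℝ} {Q : List ℝ} {F : ℕ} (hQ : (ℐ.allColours Q).card ≤ F)
    (hx : (receivedColours (ℐ.colouring Q) (ℐ.crossing x Q)).card +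
      (overlapGraph (ℐ.assigned x Q)).cliqueNum ≤ F) : (ℐ.allColours (x :: Q)).card ≤ F := by
  have hsub : ℐ.allColours (x :: Q) ⊆ Finset.Icc 1 F := by
    rw [allColours]
    refine Finset.union_subset (fun c hc => ?_) ?_
    · rw [pillarColours, Finset.mem_image] at hc
      obtain ⟨k, hk, rfl⟩ := hc
      have h1 := freeColour_le (receivedColours (ℐ.colouring Q) (ℐ.crossing x Q)) k
      have h2 := Finset.mem_range.1 hk
      exact Finset.mem_Icc.2 ⟨freeColour_pos _ _, by omega⟩
    · rw [ℐ.allColours_eq_Icc]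
      exact Finset.Icc_subset_Icc_right hQ
  simpa using Finset.card_le_card hsub

/-! ### Foundations -/

theorem mem_foundation {p y : ℝ} {Q : List ℝ} : y ∈ foundation p Q ↔
    0 < y ∧ y < 1 ∧ (∀ q ∈ Q, q < p → q < y) ∧ ∀ q ∈ Q, p < q → y < q := by
  simp only [foundation, Set.mem_Ioo, Finset.max'_lt_iff, Finset.lt_min'_iff, Finset.mem_insert,
    Finset.mem_filter, List.mem_toFinset, forall_eq_or_imp, and_imp]
  tauto

theorem openInterval_subset_foundation {p : ℝ} {Q : List ℝ} {I : ℝ × ℝ}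
    (hI : I ∈ ℐ.assigned p Q) : openInterval I ⊆ foundation p Q := by
  intro y hy
  obtain ⟨hI, hpI, hQ⟩ := ℐ.mem_assigned.1 hI
  obtain ⟨h0, -, h1⟩ := ℐ.mem_unit I hI
  refine mem_foundation.2 ⟨h0.trans_lt hy.1, hy.2.trans_le h1, fun q hq hqp => ?_,
    fun q hq hqp => ?_⟩
  · by_contra! h
    exact hQ q hq ⟨hy.1.trans_le h, hqp.trans hpI.2⟩
  · by_contra! h
    exact hQ q hq ⟨hpI.1.trans hqp, h.trans_lt hy.2⟩

theorem notMem_foundation {p q : ℝ} {Q : List ℝ} (hq : q ∈ Q) (hp : p ∉ Q) :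
    q ∉ foundation p Q := by
  intro h
  obtain ⟨-, -, h1, h2⟩ := mem_foundation.1 h
  rcases lt_trichotomy q p with hqp | rfl | hqp
  · exact lt_irrefl _ (h1 q hq hqp)
  · exact hp hq
  · exact lt_irrefl _ (h2 q hq hqp)

theorem mem_crossing {p q : ℝ} {Q : List ℝ} {I : ℝ × ℝ} (hI : I ∈ ℐ.intervals) (hp : p ∉ Q)
    (hq : q ∈ Q) (hqI : q ∈ openInterval I)
    (h : I.1 ∈ foundation p Q ∨ I.2 ∈ foundation p Q) : I ∈ ℐ.crossing p Q := by
  classical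
  have hboth : ¬ (I.1 ∈ foundation p Q ∧ I.2 ∈ foundation p Q) := fun hb =>
    notMem_foundation hq hp
      ⟨hb.1.1.trans hqI.1, hqI.2.trans hb.2.2⟩
  unfold crossing
  rw [Finset.mem_filter]
  refine ⟨hI, ?_⟩
  rcases h with h | h
  · exact Or.inl ⟨h, fun h' => hboth ⟨h, h'⟩⟩
  · exact Or.inr ⟨h, fun h' => hboth ⟨h', h⟩⟩

/-- An interval coloured before `p` is treated and having an endpoint in the foundation of `p`
shares its colour with no interval assigned to `p`. -/
theorem colouring_ne_of_mem_foundation {Q R S : List ℝ} {p q : ℝ} {I J : ℝ × ℝ}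
    (hR : p :: R <:+ Q) (hI : I ∈ ℐ.assigned p R) (hS : q :: S <:+ R) (hJ : J ∈ ℐ.assigned q S)
    (h : J.1 ∈ foundation p R ∨ J.2 ∈ foundation p R) : ℐ.colouring Q I ≠ ℐ.colouring Q J := by
  rw [ℐ.colouring_of_suffix hR hI,
    ℐ.colouring_of_suffix ((hS.trans (List.suffix_cons _ _)).trans hR) hJ]
  intro heq
  exact freeColour_notMem _ _ (mem_receivedColours.2 ⟨J, ℐ.mem_crossing (q := q)
    (ℐ.mem_assigned.1 hJ).1 (ℐ.notMem_of_mem_assigned hI) (hS.subset (by simp))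
    (ℐ.mem_assigned.1 hJ).2.1 h, (ℐ.colouring_of_suffix hS hJ).trans heq.symm⟩)

theorem colouring_ne_of_overlap {Q R S : List ℝ} {p q : ℝ} {I J : ℝ × ℝ}
    (hR : p :: R <:+ Q) (hI : I ∈ ℐ.assigned p R) (hS : q :: S <:+ R) (hJ : J ∈ ℐ.assigned q S)
    (h : Overlap I J) : ℐ.colouring Q I ≠ ℐ.colouring Q J := by
  refine ℐ.colouring_ne_of_mem_foundation hR hI hS hJ ?_
  have hsub := ℐ.openInterval_subset_foundation hI
  obtain ⟨z, hzI, hzJ⟩ := h.1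
  rcases h.strictlyBefore_or with h | h
  · exact Or.inl (hsub ⟨h.1, hzJ.1.trans hzI.2⟩)
  · exact Or.inr (hsub ⟨hzI.1.trans hzJ.2, h.2⟩)

theorem isProperPartialColouring_colouring (Q : List ℝ) :
    ℐ.IsProperPartialColouring (ℐ.colouring Q) := by
  intro I hI J hJ hIJ c hIc hJc
  obtain ⟨p, R, hR, hp⟩ :=
    ℐ.exists_suffix_mem_assigned hI (ℐ.exists_mem_of_colouring_eq_some hIc).2
  obtain ⟨q, S, hS, hq⟩ :=
    ℐ.exists_suffix_mem_assigned hJ (ℐ.exists_mem_of_colouring_eq_some hJc).2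
  rcases suffix_trichotomy hR hS with ⟨rfl, rfl⟩ | h | h
  · rw [ℐ.colouring_of_suffix hR hp] at hIc
    rw [ℐ.colouring_of_suffix hR hq, ← hIc] at hJc
    have hh := freeColour_injective _ (Option.some.inj hJc)
    have h1 := height_pos hp
    have h2 := height_pos hq
    rcases hIJ.strictlyBefore_or with h | h
    · have := height_lt_height hp hq h
      omega
    · have := height_lt_height hq hp h
      omega
  · exact ℐ.colouring_ne_of_overlap hS hq h hp hIJ.symm (hJc.trans hIc.symm)
  · exact ℐ.colouring_ne_of_overlap hR hp h hq hIJ (hIc.trans hJc.symm)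

end IntervalSystem

theorem Finset.card_image_le_card_image {α β γ : Type*} [DecidableEq β] [DecidableEq γ]
    [Nonempty α] (S : Finset α) (f : α → β) (g : α → γ)
    (h : ∀ a ∈ S, ∀ b ∈ S, g a = g b → f a = f b) : (S.image f).card ≤ (S.image g).card := by
  have hrep : ∀ k, k ∈ S.image f → ∃ a ∈ S, f a = k := fun k hk => Finset.mem_image.1 hk
  choose! rep hrep using hrep
  refine Finset.card_le_card_of_injOn (fun k => g (rep k))
    (fun k hk => Finset.mem_image_of_mem _ (hrep k hk).1) fun k hk l hl hkl => ?_
  rw [← (hrep k hk).2, ← (hrep l hl).2]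
  exact h _ (hrep k hk).1 _ (hrep l hl).1 hkl

namespace IntervalSystem

variable (ℐ : IntervalSystem)

/-! ### Counting colours inside an arch -/

open Classical in
/-- The colours, after the pillars of `Q` have been treated, of the intervals with an endpoint in
`J`. Their number is the degree of `J`. -/
noncomputable def arcColours (Q : List ℝ) (J : ℝ × ℝ) : Finset ℕ :=
  receivedColours (ℐ.colouring Q)
    (ℐ.intervals.filter fun I => I.1 ∈ openInterval J ∨ I.2 ∈ openInterval J)

theorem mem_arcColours {Q : List ℝ} {J : ℝ × ℝ} {c : ℕ} : c ∈ ℐ.arcColours Q J ↔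
    ∃ I ∈ ℐ.intervals, (I.1 ∈ openInterval J ∨ I.2 ∈ openInterval J) ∧
      ℐ.colouring Q I = some c := by
  simp only [arcColours, mem_receivedColours, Finset.mem_filter, and_assoc]

theorem arcColours_mono (Q : List ℝ) {J K : ℝ × ℝ} (h : openInterval J ⊆ openInterval K) :
    ℐ.arcColours Q J ⊆ ℐ.arcColours Q K := by
  intro c hc
  obtain ⟨I, hI, hIJ, hIc⟩ := ℐ.mem_arcColours.1 hc
  exact ℐ.mem_arcColours.2 ⟨I, hI, hIJ.imp (fun h' => h h') (fun h' => h h'), hIc⟩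

/-- The pillar to which an interval is assigned and its height among the intervals assigned to that
pillar, ordered lexicographically; `(0, 0)` for intervals that are not assigned. -/
noncomputable def key : List ℝ → ℝ × ℝ → ℝ ×ₗ ℕ
  | [], _ => toLex (0, 0)
  | p :: Q, I =>
    open Classical in
    if I ∈ ℐ.assigned p Q then toLex (p, height (ℐ.assigned p Q) I) else key Q I

theorem key_of_suffix {Q R : List ℝ} {p : ℝ} {I : ℝ × ℝ} (hR : p :: R <:+ Q)
    (hI : I ∈ ℐ.assigned p R) : ℐ.key Q I = toLex (p, height (ℐ.assigned p R) I) := by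
  induction Q with
  | nil => simp at hR
  | cons x Q ih =>
    rcases List.suffix_cons_iff.1 hR with h | h
    · obtain ⟨rfl, rfl⟩ := List.cons.inj h
      rw [key, if_pos hI]
    · rw [key, if_neg, ih h]
      intro hx
      exact (ℐ.mem_assigned.1 hx).2.2 p (h.subset (by simp)) (ℐ.mem_assigned.1 hI).2.1

/-- The two suffixes at which intervals assigned to the same pillar are assigned coincide. -/
theorem suffix_eq_of_mem_assigned {Q R S : List ℝ} {p : ℝ} {I J : ℝ × ℝ} (hR : p :: R <:+ Q)
    (hI : I ∈ ℐ.assigned p R) (hS : p :: S <:+ Q) (hJ : J ∈ ℐ.assigned p S) : R = S := by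
  rcases suffix_trichotomy hR hS with h | h | h
  · exact h.2
  · exact absurd (h.subset (by simp)) (ℐ.notMem_of_mem_assigned hJ)
  · exact absurd (h.subset (by simp)) (ℐ.notMem_of_mem_assigned hI)

theorem colouring_eq_of_key_eq {Q : List ℝ} {I J : ℝ × ℝ} (hI : I ∈ ℐ.intervals)
    (hIQ : ∃ q ∈ Q, q ∈ openInterval I) (hJ : J ∈ ℐ.intervals)
    (hJQ : ∃ q ∈ Q, q ∈ openInterval J) (h : ℐ.key Q I = ℐ.key Q J) :
    ℐ.colouring Q I = ℐ.colouring Q J := by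
  obtain ⟨p, R, hR, hp⟩ := ℐ.exists_suffix_mem_assigned hI hIQ
  obtain ⟨q, S, hS, hq⟩ := ℐ.exists_suffix_mem_assigned hJ hJQ
  rw [ℐ.key_of_suffix hR hp, ℐ.key_of_suffix hS hq] at h
  obtain ⟨rfl, hh⟩ := Prod.mk.inj (toLex.injective h)
  obtain rfl := ℐ.suffix_eq_of_mem_assigned hR hp hS hq
  rw [ℐ.colouring_of_suffix hR hp, ℐ.colouring_of_suffix hS hq, hh]

/-- If two intervals have endpoints in a common arch, then that endpoint of the one coloured first
lies in the foundation of the pillar of the other one, so that their colours differ. -/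
theorem colouring_ne_of_arch {Q R S : List ℝ} {p q a b : ℝ} {I J : ℝ × ℝ} (ha : 0 ≤ a)
    (hb : b ≤ 1) (hab : ∀ q ∈ Q, q ∉ Set.Ioo a b)
    (hR : p :: R <:+ Q) (hI : I ∈ ℐ.assigned p R) (hS : q :: S <:+ R) (hJ : J ∈ ℐ.assigned q S)
    (hIab : I.1 ∈ Set.Ioo a b ∨ I.2 ∈ Set.Ioo a b) (hJab : J.1 ∈ Set.Ioo a b ∨ J.2 ∈ Set.Ioo a b) :
    ℐ.colouring Q I ≠ ℐ.colouring Q J := by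
  have hRQ : ∀ s ∈ R, s ∈ Q := fun s hs => hR.subset (by simp [hs])
  obtain ⟨-, hpI, hIR⟩ := ℐ.mem_assigned.1 hI
  obtain ⟨e', he', he'1, he'2⟩ : ∃ e', e' ∈ Set.Ioo a b ∧ I.1 ≤ e' ∧ e' ≤ I.2 := by
    have := hpI.1.trans hpI.2
    rcases hIab with h | h
    · exact ⟨_, h, le_rfl, this.le⟩
    · exact ⟨_, h, this.le, le_rfl⟩
  have key : ∀ e ∈ Set.Ioo a b, e ∈ foundation p R := by
    intro e he
    refine mem_foundation.2 ⟨ha.trans_lt he.1, he.2.trans_le hb, fun s hs hsp => ?_,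
      fun s hs hsp => ?_⟩
    · by_contra! hes
      refine hab s (hRQ s hs) ⟨he.1.trans_le hes, ?_⟩
      by_contra! hbs
      exact hIR s hs ⟨he'1.trans_lt (he'.2.trans_le hbs), hsp.trans hpI.2⟩
    · by_contra! hes
      refine hab s (hRQ s hs) ⟨?_, hes.trans_lt he.2⟩
      by_contra! hbs
      exact hIR s hs ⟨hpI.1.trans hsp, (hbs.trans_lt he'.1).trans_le he'2⟩
  exact ℐ.colouring_ne_of_mem_foundation hR hI hS hJ (hJab.imp (key _) (key _))

theorem key_eq_of_colouring_eq {Q : List ℝ} {a b : ℝ} {I J : ℝ × ℝ} (ha : 0 ≤ a)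
    (hb : b ≤ 1) (hab : ∀ q ∈ Q, q ∉ Set.Ioo a b) (hI : I ∈ ℐ.intervals)
    (hIQ : ∃ q ∈ Q, q ∈ openInterval I) (hJ : J ∈ ℐ.intervals)
    (hJQ : ∃ q ∈ Q, q ∈ openInterval J)
    (hIab : I.1 ∈ Set.Ioo a b ∨ I.2 ∈ Set.Ioo a b) (hJab : J.1 ∈ Set.Ioo a b ∨ J.2 ∈ Set.Ioo a b)
    (h : ℐ.colouring Q I = ℐ.colouring Q J) : ℐ.key Q I = ℐ.key Q J := by
  obtain ⟨p, R, hR, hp⟩ := ℐ.exists_suffix_mem_assigned hI hIQ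
  obtain ⟨q, S, hS, hq⟩ := ℐ.exists_suffix_mem_assigned hJ hJQ
  rcases suffix_trichotomy hR hS with ⟨rfl, rfl⟩ | hs | hs
  · rw [ℐ.colouring_of_suffix hR hp, ℐ.colouring_of_suffix hS hq] at h
    have hh := freeColour_injective _ (Option.some.inj h)
    have h1 := height_pos hp
    have h2 := height_pos hq
    rw [ℐ.key_of_suffix hR hp, ℐ.key_of_suffix hS hq,
      show height (ℐ.assigned p R) I = height (ℐ.assigned p R) J by omega]
  · exact absurd h.symm (ℐ.colouring_ne_of_arch ha hb hab hS hq hs hp hJab hIab)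
  · exact absurd h (ℐ.colouring_ne_of_arch ha hb hab hR hp hs hq hIab hJab)

open Classical in
/-- The intervals containing a pillar of `Q` that have their right endpoint in `(a, b)`. -/
noncomputable def rightEndsIn (Q : List ℝ) (a b : ℝ) : Finset (ℝ × ℝ) :=
  ℐ.intervals.filter fun I => (∃ q ∈ Q, q ∈ openInterval I) ∧ I.2 ∈ Set.Ioo a b

open Classical in
/-- The intervals containing a pillar of `Q` that have their left endpoint in `(a, b)`. -/
noncomputable def leftEndsIn (Q : List ℝ) (a b : ℝ) : Finset (ℝ × ℝ) :=
  ℐ.intervals.filter fun I => (∃ q ∈ Q, q ∈ openInterval I) ∧ I.1 ∈ Set.Ioo a b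

theorem mem_rightEndsIn {Q : List ℝ} {a b : ℝ} {I : ℝ × ℝ} : I ∈ ℐ.rightEndsIn Q a b ↔
    I ∈ ℐ.intervals ∧ (∃ q ∈ Q, q ∈ openInterval I) ∧ I.2 ∈ Set.Ioo a b := by
  simp [rightEndsIn]

theorem mem_leftEndsIn {Q : List ℝ} {a b : ℝ} {I : ℝ × ℝ} : I ∈ ℐ.leftEndsIn Q a b ↔
    I ∈ ℐ.intervals ∧ (∃ q ∈ Q, q ∈ openInterval I) ∧ I.1 ∈ Set.Ioo a b := by
  simp [leftEndsIn]

theorem exists_replacement_rightEndsIn {Q : List ℝ} {a b : ℝ} (hab : ∀ q ∈ Q, q ∉ Set.Ioo a b)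
    {I J : ℝ × ℝ} (hI : I ∈ ℐ.rightEndsIn Q a b) (hJ : J ∈ ℐ.rightEndsIn Q a b)
    (hkey : ℐ.key Q I < ℐ.key Q J) (hy : I.2 < J.2) :
    ∃ K ∈ ℐ.rightEndsIn Q a b, ℐ.key Q K = ℐ.key Q I ∧ I.2 ≤ K.2 ∧ StrictlyBefore K J := by
  obtain ⟨hI', hIQ, hIab⟩ := ℐ.mem_rightEndsIn.1 hI
  obtain ⟨hJ', hJQ, hJab⟩ := ℐ.mem_rightEndsIn.1 hJ
  obtain ⟨p, R, hR, hp⟩ := ℐ.exists_suffix_mem_assigned hI' hIQ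
  obtain ⟨q, S, hS, hq⟩ := ℐ.exists_suffix_mem_assigned hJ' hJQ
  have hpQ : p ∈ Q := hR.subset (by simp)
  have hqQ : q ∈ Q := hS.subset (by simp)
  have hpI := (ℐ.mem_assigned.1 hp).2.1
  have hqJ := (ℐ.mem_assigned.1 hq).2.1
  rw [ℐ.key_of_suffix hR hp, ℐ.key_of_suffix hS hq, Prod.Lex.toLex_lt_toLex] at hkey
  rcases hkey with hpq | ⟨hpq, hh⟩
  · have hqa : q ≤ a := by
      by_contra! h
      exact hab q hqQ ⟨h, hqJ.2.trans hJab.2⟩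
    have hqI : q ∈ openInterval I := ⟨hpI.1.trans hpq, hqa.trans_lt hIab.1⟩
    have hpS : p ∈ S := by
      rcases suffix_trichotomy hR hS with h | h | h
      · exact absurd h.1 hpq.ne
      · exact h.subset (by simp)
      · exact absurd hqI ((ℐ.mem_assigned.1 hp).2.2 q (h.subset (by simp)))
    refine ⟨I, hI, rfl, le_rfl, hpI.1.trans_le ?_, hy⟩
    by_contra! h
    exact (ℐ.mem_assigned.1 hq).2.2 p hpS ⟨h, hpq.trans hqJ.2⟩
  · simp only at hpq hh
    subst hpq
    obtain rfl := ℐ.suffix_eq_of_mem_assigned hR hp hS hq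
    obtain ⟨K, hK, hKh, hIK, hKJ⟩ := exists_strictlyBefore_of_height_lt hp hq hh
      (x := Prod.fst) (y := Prod.snd) (fun _ _ => Iff.rfl) hy
    refine ⟨K, ℐ.mem_rightEndsIn.2 ⟨ℐ.assigned_subset _ _ hK, ⟨p, hpQ,
      (ℐ.mem_assigned.1 hK).2.1⟩, hIab.1.trans_le hIK, hKJ.2.trans hJab.2⟩, ?_, hIK, hKJ⟩
    rw [ℐ.key_of_suffix hR hK, ℐ.key_of_suffix hR hp, hKh]

theorem exists_replacement_leftEndsIn {Q : List ℝ} {a b : ℝ} (hab : ∀ q ∈ Q, q ∉ Set.Ioo a b)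
    {I J : ℝ × ℝ} (hI : I ∈ ℐ.leftEndsIn Q a b) (hJ : J ∈ ℐ.leftEndsIn Q a b)
    (hkey : ℐ.key Q I < ℐ.key Q J) (hy : I.1 < J.1) :
    ∃ K ∈ ℐ.leftEndsIn Q a b, ℐ.key Q K = ℐ.key Q I ∧ I.1 ≤ K.1 ∧ StrictlyBefore K J := by
  obtain ⟨hI', hIQ, hIab⟩ := ℐ.mem_leftEndsIn.1 hI
  obtain ⟨hJ', hJQ, hJab⟩ := ℐ.mem_leftEndsIn.1 hJ
  obtain ⟨p, R, hR, hp⟩ := ℐ.exists_suffix_mem_assigned hI' hIQ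
  obtain ⟨q, S, hS, hq⟩ := ℐ.exists_suffix_mem_assigned hJ' hJQ
  have hpQ : p ∈ Q := hR.subset (by simp)
  have hqQ : q ∈ Q := hS.subset (by simp)
  have hpI := (ℐ.mem_assigned.1 hp).2.1
  have hqJ := (ℐ.mem_assigned.1 hq).2.1
  rw [ℐ.key_of_suffix hR hp, ℐ.key_of_suffix hS hq, Prod.Lex.toLex_lt_toLex] at hkey
  rcases hkey with hpq | ⟨hpq, hh⟩
  · have hbp : b ≤ p := by
      by_contra! h
      exact hab p hpQ ⟨hIab.1.trans hpI.1, h⟩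
    have hpJ : p ∈ openInterval J := ⟨hJab.2.trans_le hbp, hpq.trans hqJ.2⟩
    have hqR : q ∈ R := by
      rcases suffix_trichotomy hR hS with h | h | h
      · exact absurd h.1 hpq.ne
      · exact absurd hpJ ((ℐ.mem_assigned.1 hq).2.2 p (h.subset (by simp)))
      · exact h.subset (by simp)
    refine ⟨I, hI, rfl, le_rfl, hy, lt_of_le_of_lt ?_ hqJ.2⟩
    by_contra! h
    exact (ℐ.mem_assigned.1 hp).2.2 q hqR ⟨hpI.1.trans hpq, h⟩
  · simp only at hpq hh
    subst hpq
    obtain rfl := ℐ.suffix_eq_of_mem_assigned hR hp hS hq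
    obtain ⟨K, hK, hKh, hIK, hKJ⟩ := exists_strictlyBefore_of_height_lt hp hq hh
      (x := Prod.snd) (y := Prod.fst) (fun _ _ => And.comm) hy
    refine ⟨K, ℐ.mem_leftEndsIn.2 ⟨ℐ.assigned_subset _ _ hK, ⟨p, hpQ,
      (ℐ.mem_assigned.1 hK).2.1⟩, hIab.1.trans_le hIK, hKJ.1.trans hJab.2⟩, ?_, hIK, hKJ⟩
    rw [ℐ.key_of_suffix hR hK, ℐ.key_of_suffix hR hp, hKh]

theorem mem_openInterval_of_mem_rightEndsIn {Q : List ℝ} {a b : ℝ}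
    (hab : ∀ q ∈ Q, q ∉ Set.Ioo a b) {I : ℝ × ℝ} (hI : I ∈ ℐ.rightEndsIn Q a b) :
    a ∈ openInterval I := by
  obtain ⟨-, ⟨q, hq, hqI⟩, hIab⟩ := ℐ.mem_rightEndsIn.1 hI
  refine ⟨hqI.1.trans_le ?_, hIab.1⟩
  by_contra! h
  exact hab q hq ⟨h, hqI.2.trans hIab.2⟩

theorem mem_openInterval_of_mem_leftEndsIn {Q : List ℝ} {a b : ℝ}
    (hab : ∀ q ∈ Q, q ∉ Set.Ioo a b) {I : ℝ × ℝ} (hI : I ∈ ℐ.leftEndsIn Q a b) :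
    b ∈ openInterval I := by
  obtain ⟨-, ⟨q, hq, hqI⟩, hIab⟩ := ℐ.mem_leftEndsIn.1 hI
  refine ⟨hIab.2, lt_of_le_of_lt ?_ hqI.2⟩
  by_contra! h
  exact hab q hq ⟨hIab.1.trans hqI.1, h⟩

/-- If the windows `(u x, x)` are disjoint, then choosing keys that increase from window to window
yields a clique as long as the choice, whence the staircase bound. -/
theorem sum_card_image_key_le {κ : Type*} [LinearOrder κ] {Z : Finset (ℝ × ℝ)}
    (hZ : Z ⊆ ℐ.intervals) {z : ℝ} (hz : ∀ I ∈ Z, z ∈ openInterval I) (key : ℝ × ℝ → κ)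
    (y : ℝ × ℝ → ℝ)
    (hrep : ∀ I ∈ Z, ∀ J ∈ Z, key I < key J → y I < y J →
      ∃ K ∈ Z, key K = key I ∧ y I ≤ y K ∧ StrictlyBefore K J)
    (X : Finset ℝ) (u : ℝ → ℝ) (hu : ∀ x ∈ X, ∀ x' ∈ X, x' ≤ u x ∨ x ≤ x') :
    ∑ x ∈ X, ((Z.filter fun I => u x < y I ∧ y I < x).image key).card ≤
      (overlapGraph ℐ.intervals).cliqueNum * (X.card + (Z.image key).card) := by
  classical
  let T := (X ×ˢ Z.image key).filter fun s =>
    s.2 ∈ (Z.filter fun I => u s.1 < y I ∧ y I < s.1).image key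
  have hTcard : T.card =
      ∑ x ∈ X, ((Z.filter fun I => u x < y I ∧ y I < x).image key).card := by
    rw [Finset.card_filter, Finset.sum_product]
    refine Finset.sum_congr rfl fun x _ => ?_
    rw [← Finset.card_filter]
    congr 1
    ext k
    rw [Finset.mem_filter, and_iff_right_iff_imp]
    exact fun hk => Finset.image_subset_image (Finset.filter_subset _ _) hk
  rw [← hTcard]
  refine card_le_of_forall_pairwise_length_le X (Z.image key) _ T (Finset.filter_subset _ _)
    fun l hl hlT => ?_
  have hex : ∀ s, s ∈ T → ∃ I ∈ Z, (u s.1 < y I ∧ y I < s.1) ∧ key I = s.2 := by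
    intro s hs
    obtain ⟨I, hI, hIs⟩ := Finset.mem_image.1 (Finset.mem_filter.1 hs).2
    exact ⟨I, (Finset.mem_filter.1 hI).1, (Finset.mem_filter.1 hI).2, hIs⟩
  choose! f hfZ hfy hfkey using hex
  rcases l with _ | ⟨s, l⟩
  · simp
  have hpair : ((s :: l).map f).Pairwise fun A B => key A < key B ∧ y A < y B := by
    rw [List.pairwise_map]
    refine hl.imp_of_mem fun {s t} hs ht hst => ?_
    have hsT := hlT s hs
    have htT := hlT t ht
    refine ⟨by rw [hfkey s hsT, hfkey t htT]; exact hst.2, ?_⟩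
    have hsX := (Finset.mem_product.1 (Finset.mem_filter.1 hsT).1).1
    have htX := (Finset.mem_product.1 (Finset.mem_filter.1 htT).1).1
    have h1 : s.1 ≤ u t.1 := (hu t.1 htX s.1 hsX).resolve_right (not_le.2 hst.1)
    exact ((hfy s hsT).2.trans_le h1).trans (hfy t htT).1
  rw [List.map_cons] at hpair
  obtain ⟨I', l', hlen, hl', hmem, -, -⟩ := exists_pairwise_strictlyBefore (Z : Set (ℝ × ℝ)) key y
    hrep (l.map f) (f s) hpair fun A hA => by
      rw [← List.map_cons, List.mem_map] at hA
      obtain ⟨t, ht, rfl⟩ := hA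
      exact hfZ t (hlT t ht)
  have := length_le_cliqueNum_of_pairwise hl' (fun I hI => hZ (hmem I hI)) fun I hI =>
    hz I (hmem I hI)
  simpa [hlen] using this

theorem card_receivedColours_le {ψ : ℝ × ℝ → Option ℕ} {S : Finset (ℝ × ℝ)} :
    (receivedColours ψ S).card ≤ (S.image ψ).card := by
  rw [← Finset.card_image_of_injective _ (Option.some_injective ℕ)]
  refine Finset.card_le_card fun o ho => ?_
  obtain ⟨c, hc, rfl⟩ := Finset.mem_image.1 ho
  obtain ⟨I, hI, hIc⟩ := mem_receivedColours.1 hc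
  exact Finset.mem_image.2 ⟨I, hI, hIc⟩

theorem card_image_le_card_receivedColours {ψ : ℝ × ℝ → Option ℕ} {S : Finset (ℝ × ℝ)}
    (h : ∀ I ∈ S, ∃ c, ψ I = some c) : (S.image ψ).card ≤ (receivedColours ψ S).card := by
  rw [← Finset.card_image_of_injective (receivedColours ψ S) (Option.some_injective ℕ)]
  refine Finset.card_le_card fun o ho => ?_
  obtain ⟨I, hI, rfl⟩ := Finset.mem_image.1 ho
  obtain ⟨c, hc⟩ := h I hI
  exact Finset.mem_image.2 ⟨c, mem_receivedColours.2 ⟨I, hI, hc⟩, hc.symm⟩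

theorem exists_colouring_eq_some {Q : List ℝ} {I : ℝ × ℝ} (hI : I ∈ ℐ.intervals)
    (hIQ : ∃ q ∈ Q, q ∈ openInterval I) : ∃ c, ℐ.colouring Q I = some c := by
  obtain ⟨p, R, hR, hp⟩ := ℐ.exists_suffix_mem_assigned hI hIQ
  exact ⟨_, ℐ.colouring_of_suffix hR hp⟩

theorem card_image_key_add_le {Q : List ℝ} {a b : ℝ} (ha : 0 ≤ a) (hb : b ≤ 1)
    (hab : ∀ q ∈ Q, q ∉ Set.Ioo a b) :
    ((ℐ.rightEndsIn Q a b).image (ℐ.key Q)).card + ((ℐ.leftEndsIn Q a b).image (ℐ.key Q)).card ≤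
      (ℐ.arcColours Q (a, b)).card := by
  set A := ℐ.rightEndsIn Q a b
  set B := ℐ.leftEndsIn Q a b
  have hA : (A.image (ℐ.key Q)).card ≤ (receivedColours (ℐ.colouring Q) A).card := by
    refine (Finset.card_image_le_card_image A _ (ℐ.colouring Q) fun I hI J hJ h => ?_).trans
      (card_image_le_card_receivedColours fun I hI => ?_)
    · obtain ⟨hI, hIQ, hIab⟩ := ℐ.mem_rightEndsIn.1 hI
      obtain ⟨hJ, hJQ, hJab⟩ := ℐ.mem_rightEndsIn.1 hJ
      exact ℐ.key_eq_of_colouring_eq ha hb hab hI hIQ hJ hJQ (Or.inr hIab) (Or.inr hJab) h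
    · obtain ⟨hI, hIQ, -⟩ := ℐ.mem_rightEndsIn.1 hI
      exact ℐ.exists_colouring_eq_some hI hIQ
  have hB : (B.image (ℐ.key Q)).card ≤ (receivedColours (ℐ.colouring Q) B).card := by
    refine (Finset.card_image_le_card_image B _ (ℐ.colouring Q) fun I hI J hJ h => ?_).trans
      (card_image_le_card_receivedColours fun I hI => ?_)
    · obtain ⟨hI, hIQ, hIab⟩ := ℐ.mem_leftEndsIn.1 hI
      obtain ⟨hJ, hJQ, hJab⟩ := ℐ.mem_leftEndsIn.1 hJ
      exact ℐ.key_eq_of_colouring_eq ha hb hab hI hIQ hJ hJQ (Or.inl hIab) (Or.inl hJab) h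
    · obtain ⟨hI, hIQ, -⟩ := ℐ.mem_leftEndsIn.1 hI
      exact ℐ.exists_colouring_eq_some hI hIQ
  have hdisj : Disjoint (receivedColours (ℐ.colouring Q) A)
      (receivedColours (ℐ.colouring Q) B) := by
    rw [Finset.disjoint_left]
    intro c hcA hcB
    obtain ⟨I, hIA, hIc⟩ := mem_receivedColours.1 hcA
    obtain ⟨J, hJB, hJc⟩ := mem_receivedColours.1 hcB
    obtain ⟨hI, hIQ, hIab⟩ := ℐ.mem_rightEndsIn.1 hIA
    obtain ⟨hJ, hJQ, hJab⟩ := ℐ.mem_leftEndsIn.1 hJB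
    have hkey := ℐ.key_eq_of_colouring_eq ha hb hab hI hIQ hJ hJQ (Or.inr hIab) (Or.inl hJab)
      (hIc.trans hJc.symm)
    obtain ⟨p, R, hR, hp⟩ := ℐ.exists_suffix_mem_assigned hI hIQ
    obtain ⟨q, S, hS, hq⟩ := ℐ.exists_suffix_mem_assigned hJ hJQ
    rw [ℐ.key_of_suffix hR hp, ℐ.key_of_suffix hS hq] at hkey
    obtain ⟨rfl, -⟩ := Prod.mk.inj (toLex.injective hkey)
    -- The common pillar would be to the left of an endpoint in the arch and to the right of one.
    exact hab p (hR.subset (by simp))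
      ⟨hJab.1.trans (ℐ.mem_assigned.1 hq).2.1.1, (ℐ.mem_assigned.1 hp).2.1.2.trans hIab.2⟩
  calc _ ≤ _ := Nat.add_le_add hA hB
    _ = (receivedColours (ℐ.colouring Q) A ∪ receivedColours (ℐ.colouring Q) B).card :=
      (Finset.card_union_of_disjoint hdisj).symm
    _ ≤ _ := by
      refine Finset.card_le_card (Finset.union_subset (fun c hc => ?_) fun c hc => ?_)
      · obtain ⟨I, hI, hIc⟩ := mem_receivedColours.1 hc
        obtain ⟨hI, -, hIab⟩ := ℐ.mem_rightEndsIn.1 hI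
        exact ℐ.mem_arcColours.2 ⟨I, hI, Or.inr hIab, hIc⟩
      · obtain ⟨I, hI, hIc⟩ := mem_receivedColours.1 hc
        obtain ⟨hI, -, hIab⟩ := ℐ.mem_leftEndsIn.1 hI
        exact ℐ.mem_arcColours.2 ⟨I, hI, Or.inl hIab, hIc⟩

theorem card_arcColours_le {Q : List ℝ} {a b u x : ℝ} (hu : a ≤ u) (hx : x ≤ b) :
    (ℐ.arcColours Q (u, x)).card ≤
      (((ℐ.rightEndsIn Q a b).filter fun I => u < I.2 ∧ I.2 < x).image (ℐ.key Q)).card +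
      (((ℐ.leftEndsIn Q a b).filter fun I => u < I.1 ∧ I.1 < x).image (ℐ.key Q)).card := by
  set A := (ℐ.rightEndsIn Q a b).filter fun I => u < I.2 ∧ I.2 < x
  set B := (ℐ.leftEndsIn Q a b).filter fun I => u < I.1 ∧ I.1 < x
  have hA : (receivedColours (ℐ.colouring Q) A).card ≤ (A.image (ℐ.key Q)).card := by
    refine card_receivedColours_le.trans
      (Finset.card_image_le_card_image A _ _ fun I hI J hJ h => ?_)
    obtain ⟨hI, hIQ, -⟩ := ℐ.mem_rightEndsIn.1 (Finset.mem_filter.1 hI).1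
    obtain ⟨hJ, hJQ, -⟩ := ℐ.mem_rightEndsIn.1 (Finset.mem_filter.1 hJ).1
    exact ℐ.colouring_eq_of_key_eq hI hIQ hJ hJQ h
  have hB : (receivedColours (ℐ.colouring Q) B).card ≤ (B.image (ℐ.key Q)).card := by
    refine card_receivedColours_le.trans
      (Finset.card_image_le_card_image B _ _ fun I hI J hJ h => ?_)
    obtain ⟨hI, hIQ, -⟩ := ℐ.mem_leftEndsIn.1 (Finset.mem_filter.1 hI).1
    obtain ⟨hJ, hJQ, -⟩ := ℐ.mem_leftEndsIn.1 (Finset.mem_filter.1 hJ).1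
    exact ℐ.colouring_eq_of_key_eq hI hIQ hJ hJQ h
  refine le_trans ?_ (Nat.add_le_add hA hB)
  refine (Finset.card_le_card fun c hc => ?_).trans (Finset.card_union_le _ _)
  obtain ⟨I, hI, hIJ, hIc⟩ := ℐ.mem_arcColours.1 hc
  have hIQ := (ℐ.exists_mem_of_colouring_eq_some hIc).2
  rw [Finset.mem_union]
  rcases hIJ with h | h
  · exact Or.inr (mem_receivedColours.2 ⟨I, Finset.mem_filter.2 ⟨ℐ.mem_leftEndsIn.2
      ⟨hI, hIQ, hu.trans_lt h.1, h.2.trans_le hx⟩, h⟩, hIc⟩)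
  · exact Or.inl (mem_receivedColours.2 ⟨I, Finset.mem_filter.2 ⟨ℐ.mem_rightEndsIn.2
      ⟨hI, hIQ, hu.trans_lt h.1, h.2.trans_le hx⟩, h⟩, hIc⟩)

/-- An arch cannot be cut into many windows in each of which `t` colours are seen: bounding the
right and the left endpoints separately, each side contributes at most
`ω * (number of windows + number of its keys)`. -/
theorem card_mul_le_of_windows {Q : List ℝ} {a b : ℝ} (ha : 0 ≤ a) (hb : b ≤ 1)
    (hab : ∀ q ∈ Q, q ∉ Set.Ioo a b) (X : Finset ℝ) (t : ℕ)
    (hX : ∀ x ∈ X, ∃ u, a ≤ u ∧ x ≤ b ∧ (∀ x' ∈ X, x' ≤ u ∨ x ≤ x') ∧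
      t ≤ (ℐ.arcColours Q (u, x)).card) :
    X.card * t ≤ (overlapGraph ℐ.intervals).cliqueNum *
      (2 * X.card + (ℐ.arcColours Q (a, b)).card) := by
  choose! u hau hxb hu ht using hX
  have hA := ℐ.sum_card_image_key_le (Z := ℐ.rightEndsIn Q a b) (z := a)
    (fun I hI => (ℐ.mem_rightEndsIn.1 hI).1)
    (fun I hI => ℐ.mem_openInterval_of_mem_rightEndsIn hab hI) (ℐ.key Q) Prod.snd
    (fun I hI J hJ => ℐ.exists_replacement_rightEndsIn hab hI hJ) X u hu
  have hB := ℐ.sum_card_image_key_le (Z := ℐ.leftEndsIn Q a b) (z := b)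
    (fun I hI => (ℐ.mem_leftEndsIn.1 hI).1)
    (fun I hI => ℐ.mem_openInterval_of_mem_leftEndsIn hab hI) (ℐ.key Q) Prod.fst
    (fun I hI J hJ => ℐ.exists_replacement_leftEndsIn hab hI hJ) X u hu
  calc X.card * t = ∑ x ∈ X, t := by rw [Finset.sum_const, smul_eq_mul]
    _ ≤ ∑ x ∈ X, _ := Finset.sum_le_sum fun x hx =>
      (ht x hx).trans (ℐ.card_arcColours_le (hau x hx) (hxb x hx))
    _ = _ := Finset.sum_add_distrib
    _ ≤ _ := Nat.add_le_add hA hB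
    _ = (overlapGraph ℐ.intervals).cliqueNum * (2 * X.card +
        (((ℐ.rightEndsIn Q a b).image (ℐ.key Q)).card +
          ((ℐ.leftEndsIn Q a b).image (ℐ.key Q)).card)) := by ring
    _ ≤ _ := Nat.mul_le_mul_left _
      (Nat.add_le_add_left (ℐ.card_image_key_add_le ha hb hab) _)

end IntervalSystem

theorem Finset.exists_mem_card_filter_lt_two_pow {X : Finset ℝ} (hX : X.Nonempty) {n : ℕ}
    (hn : X.card < 2 ^ (n + 1)) :
    ∃ x ∈ X, (X.filter (· < x)).card < 2 ^ n ∧ (X.filter (x < ·)).card < 2 ^ n := by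
  classical
  let A := X.filter fun x => (X.filter (x < ·)).card < 2 ^ n
  have hA : A.Nonempty := by
    refine ⟨X.max' hX, Finset.mem_filter.2 ⟨X.max'_mem hX, ?_⟩⟩
    rw [Finset.filter_false_of_mem fun y hy => not_lt.2 (X.le_max' y hy)]
    simp
  have hx := Finset.mem_filter.1 (A.min'_mem hA)
  refine ⟨A.min' hA, hx.1, ?_, hx.2⟩
  rcases (X.filter (· < A.min' hA)).eq_empty_or_nonempty with h | h
  · rw [h]
    simp
  · set y := (X.filter (· < A.min' hA)).max' h
    have hy := Finset.mem_filter.1 ((X.filter (· < A.min' hA)).max'_mem h)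
    have hyA : ¬ (X.filter (y < ·)).card < 2 ^ n := fun hlt =>
      absurd (A.min'_le y (Finset.mem_filter.2 ⟨hy.1, hlt⟩)) (not_le.2 hy.2)
    have hdisj : Disjoint (X.filter (· < A.min' hA)) (X.filter (y < ·)) := by
      rw [Finset.disjoint_left]
      intro z hz hz'
      exact absurd ((X.filter (· < A.min' hA)).le_max' z hz)
        (not_le.2 (Finset.mem_filter.1 hz').2)
    have hcard := Finset.card_le_card (Finset.union_subset
      (Finset.filter_subset (· < A.min' hA) X) (Finset.filter_subset (y < ·) X))
    rw [Finset.card_union_of_disjoint hdisj] at hcard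
    rw [pow_succ] at hn
    omega

namespace IntervalSystem

variable (ℐ : IntervalSystem)

/-! ### Adding pillars inside an arch -/

theorem foundation_subset_of_arch {Q : List ℝ} {a b x : ℝ} (ha : a = 0 ∨ a ∈ Q)
    (hb : b = 1 ∨ b ∈ Q) (hx : x ∈ Set.Ioo a b) : foundation x Q ⊆ Set.Ioo a b := by
  intro y hy
  obtain ⟨h0, h1, hl, hr⟩ := mem_foundation.1 hy
  refine ⟨?_, ?_⟩
  · rcases ha with rfl | ha
    · exact h0
    · exact hl a ha hx.1
  · rcases hb with rfl | hb
    · exact h1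
    · exact hr b hb hx.2

theorem receivedColours_crossing_subset {Q : List ℝ} {a b x : ℝ} (ha : a = 0 ∨ a ∈ Q)
    (hb : b = 1 ∨ b ∈ Q) (hx : x ∈ Set.Ioo a b) :
    receivedColours (ℐ.colouring Q) (ℐ.crossing x Q) ⊆ ℐ.arcColours Q (a, b) := by
  classical
  intro c hc
  obtain ⟨I, hI, hIc⟩ := mem_receivedColours.1 hc
  unfold crossing at hI
  obtain ⟨hI, hIF⟩ := Finset.mem_filter.1 hI
  have hsub := foundation_subset_of_arch ha hb hx
  exact ℐ.mem_arcColours.2 ⟨I, hI, hIF.imp (fun h => hsub h.1) (fun h => hsub h.1), hIc⟩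

theorem subset_arch_of_mem_assigned {Q : List ℝ} {a b x : ℝ} (ha : a = 0 ∨ a ∈ Q)
    (hb : b = 1 ∨ b ∈ Q) (hx : x ∈ Set.Ioo a b) {I : ℝ × ℝ} (hI : I ∈ ℐ.assigned x Q) :
    a ≤ I.1 ∧ I.2 ≤ b := by
  obtain ⟨hI, hxI, hQ⟩ := ℐ.mem_assigned.1 hI
  obtain ⟨h0, -, h1⟩ := ℐ.mem_unit I hI
  refine ⟨?_, ?_⟩
  · rcases ha with rfl | ha
    · exact h0
    · by_contra! h
      exact hQ a ha ⟨h, hx.1.trans hxI.2⟩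
  · rcases hb with rfl | hb
    · exact h1
    · by_contra! h
      exact hQ b hb ⟨hxI.1.trans hx.2, h⟩

theorem card_pillarColours_le (x : ℝ) (Q : List ℝ) :
    (ℐ.pillarColours x Q).card ≤ (overlapGraph ℐ.intervals).cliqueNum := by
  rw [pillarColours]
  refine Finset.card_image_le.trans ?_
  rw [Finset.card_range]
  exact overlapGraph_cliqueNum_mono (ℐ.assigned_subset x Q)

theorem card_arcColours_cons_le (x : ℝ) (Q : List ℝ) (J : ℝ × ℝ) :
    (ℐ.arcColours (x :: Q) J).card ≤
      (ℐ.arcColours Q J).card + (overlapGraph ℐ.intervals).cliqueNum := by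
  refine le_trans ?_ (Nat.add_le_add_left (ℐ.card_pillarColours_le x Q) _)
  refine (Finset.card_le_card fun c hc => ?_).trans (Finset.card_union_le _ _)
  obtain ⟨I, hI, hIJ, hIc⟩ := ℐ.mem_arcColours.1 hc
  rw [Finset.mem_union]
  by_cases hx : I ∈ ℐ.assigned x Q
  · right
    rw [ℐ.colouring_cons_of_mem hx] at hIc
    rw [pillarColours, ← Option.some.inj hIc]
    refine Finset.mem_image_of_mem _ (Finset.mem_range.2 ?_)
    have h1 := ℐ.height_le_cliqueNum hx
    have h2 := height_pos hx
    omega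
  · rw [ℐ.colouring_cons_of_notMem hx] at hIc
    exact Or.inl (ℐ.mem_arcColours.2 ⟨I, hI, hIJ, hIc⟩)

theorem arcColours_cons_subset {Q : List ℝ} {a b x : ℝ} (ha : a = 0 ∨ a ∈ Q)
    (hb : b = 1 ∨ b ∈ Q) (hx : x ∈ Set.Ioo a b) {J : ℝ × ℝ} (hJ : J.2 ≤ a ∨ b ≤ J.1) :
    ℐ.arcColours (x :: Q) J ⊆ ℐ.arcColours Q J := by
  intro c hc
  obtain ⟨I, hI, hIJ, hIc⟩ := ℐ.mem_arcColours.1 hc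
  rw [ℐ.colouring_cons_of_notMem] at hIc
  · exact ℐ.mem_arcColours.2 ⟨I, hI, hIJ, hIc⟩
  · intro hxI
    obtain ⟨h1, h2⟩ := ℐ.subset_arch_of_mem_assigned ha hb hx hxI
    have h3 := (ℐ.mem_unit I hI).2.1
    rcases hIJ with h | h <;> have h4 := h.1 <;> have h5 := h.2 <;>
      rcases hJ with hJ | hJ <;> linarith

/-- Treating the points of `X` in the order of a binary search, the median first, at most `n` of
the new pillars have a foundation containing a given interval `J` that avoids `X`. -/
theorem exists_list_of_card_lt_two_pow {n F : ℕ} {Q : List ℝ} {a b : ℝ} {X : Finset ℝ}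
    (ha : a = 0 ∨ a ∈ Q) (hb : b = 1 ∨ b ∈ Q)
    (hX : ∀ x ∈ X, x ∈ Set.Ioo a b) (hn : X.card < 2 ^ n)
    (hF : (ℐ.arcColours Q (a, b)).card + n * (overlapGraph ℐ.intervals).cliqueNum ≤ F)
    (hQ : (ℐ.allColours Q).card ≤ F) :
    ∃ L : List ℝ, L.Nodup ∧ (∀ x, x ∈ L ↔ x ∈ X) ∧ (ℐ.allColours (L ++ Q)).card ≤ F ∧
      (∀ J : ℝ × ℝ, a ≤ J.1 → J.2 ≤ b → (∀ x ∈ X, x ≤ J.1 ∨ J.2 ≤ x) →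
        (ℐ.arcColours (L ++ Q) J).card ≤
          (ℐ.arcColours Q J).card + n * (overlapGraph ℐ.intervals).cliqueNum) ∧
      ∀ J : ℝ × ℝ, J.2 ≤ a ∨ b ≤ J.1 → ℐ.arcColours (L ++ Q) J ⊆ ℐ.arcColours Q J := by
  induction n generalizing Q a b X with
  | zero =>
    have : X = ∅ := by simpa using hn
    subst this
    exact ⟨[], by simp, by simp, by simpa using hQ, by simp, by simp⟩
  | succ n ih =>
    set w := (overlapGraph ℐ.intervals).cliqueNum
    rcases X.eq_empty_or_nonempty with rfl | hne
    · exact ⟨[], by simp, by simp, by simpa using hQ, by simp, by simp⟩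
    obtain ⟨x, hx, hleft, hright⟩ := Finset.exists_mem_card_filter_lt_two_pow hne hn
    have hxab := hX x hx
    rw [Nat.succ_mul] at hF
    have hQ1 : (ℐ.allColours (x :: Q)).card ≤ F := by
      refine ℐ.card_allColours_cons_le hQ ?_
      have h1 := Finset.card_le_card (ℐ.receivedColours_crossing_subset ha hb hxab)
      have h2 : (overlapGraph (ℐ.assigned x Q)).cliqueNum ≤ w :=
        overlapGraph_cliqueNum_mono (ℐ.assigned_subset x Q)
      omega
    have hax := Finset.card_le_card (ℐ.arcColours_mono Q (J := (a, x)) (K := (a, b))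
      (Set.Ioo_subset_Ioo_right hxab.2.le))
    have hxb := Finset.card_le_card (ℐ.arcColours_mono Q (J := (x, b)) (K := (a, b))
      (Set.Ioo_subset_Ioo_left hxab.1.le))
    have hax' := ℐ.card_arcColours_cons_le x Q (a, x)
    have hxb' := ℐ.card_arcColours_cons_le x Q (x, b)
    obtain ⟨L₁, hL₁, hmem₁, hcol₁, hin₁, hout₁⟩ := ih (Q := x :: Q) (a := a) (b := x)
      (X := X.filter (· < x)) (ha.imp_right fun h => by simp [h]) (Or.inr (by simp))
      (fun y hy => ⟨(hX y (Finset.mem_filter.1 hy).1).1, (Finset.mem_filter.1 hy).2⟩) hleft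
      (by omega) hQ1
    have hxb'' := Finset.card_le_card (hout₁ (x, b) (Or.inr le_rfl))
    obtain ⟨L₂, hL₂, hmem₂, hcol₂, hin₂, hout₂⟩ := ih (Q := L₁ ++ x :: Q) (a := x) (b := b)
      (X := X.filter (x < ·)) (Or.inr (by simp)) (hb.imp_right fun h => by simp [h])
      (fun y hy => ⟨(Finset.mem_filter.1 hy).2, (hX y (Finset.mem_filter.1 hy).1).2⟩) hright
      (by omega) hcol₁
    have happ : L₂ ++ (L₁ ++ x :: Q) = (L₂ ++ L₁ ++ [x]) ++ Q := by simp
    rw [happ] at hcol₂ hin₂ hout₂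
    refine ⟨L₂ ++ L₁ ++ [x], ?_, ?_, hcol₂, ?_, ?_⟩
    · rw [List.append_assoc, List.nodup_append, List.nodup_append]
      simp only [hL₁, hL₂, hmem₁, hmem₂, List.nodup_singleton, true_and, List.mem_append,
        Finset.mem_filter, List.mem_singleton]
      refine ⟨?_, ?_⟩
      · rintro y hy z rfl rfl
        exact lt_irrefl _ hy.2
      · rintro y hy z (hz | rfl) rfl
        · exact lt_asymm hy.2 hz.2
        · exact lt_irrefl _ hy.2
    · intro y
      simp only [List.mem_append, hmem₁, hmem₂, Finset.mem_filter, List.mem_singleton]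
      constructor
      · rintro ((h | h) | rfl)
        · exact h.1
        · exact h.1
        · exact hx
      · intro hy
        rcases lt_trichotomy y x with h | h | h
        · exact Or.inl (Or.inr ⟨hy, h⟩)
        · exact Or.inr h
        · exact Or.inl (Or.inl ⟨hy, h⟩)
    · intro J haJ hJb hJX
      have hJ := ℐ.card_arcColours_cons_le x Q J
      rw [Nat.succ_mul]
      rcases hJX x hx with h | h
      · have h1 := hin₂ J h hJb fun y hy => hJX y (Finset.mem_filter.1 hy).1
        have h2 := Finset.card_le_card (hout₁ J (Or.inr h))
        omega
      · have h1 := hin₁ J haJ h fun y hy => hJX y (Finset.mem_filter.1 hy).1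
        have h2 := Finset.card_le_card (hout₂ J (Or.inl h))
        omega
    · intro J hJ
      refine (hout₂ J ?_).trans ((hout₁ J ?_).trans (ℐ.arcColours_cons_subset ha hb hxab hJ))
      · exact hJ.imp_left fun h => h.trans hxab.1.le
      · exact hJ.imp_right fun h => hxab.2.le.trans h

/-! ### Cutting an arch into windows with few colours -/

open Classical in
/-- The endpoints of the intervals of the system. -/
noncomputable def endpoints : Finset ℝ :=
  ℐ.intervals.image Prod.fst ∪ ℐ.intervals.image Prod.snd

theorem mem_endpoints {e : ℝ} :
    e ∈ ℐ.endpoints ↔ ∃ I ∈ ℐ.intervals, I.1 = e ∨ I.2 = e := by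
  simp only [endpoints, Finset.mem_union, Finset.mem_image]
  constructor
  · rintro (⟨I, hI, h⟩ | ⟨I, hI, h⟩)
    · exact ⟨I, hI, Or.inl h⟩
    · exact ⟨I, hI, Or.inr h⟩
  · rintro ⟨I, hI, h | h⟩
    · exact Or.inl ⟨I, hI, h⟩
    · exact Or.inr ⟨I, hI, h⟩

theorem isPillar_iff {p : ℝ} : ℐ.IsPillar p ↔ p ∈ Set.Ioo (0 : ℝ) 1 ∧ p ∉ ℐ.endpoints := by
  rw [IsPillar, mem_endpoints]
  refine and_congr_right fun _ => ⟨?_, fun h I hI => ⟨?_, ?_⟩⟩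
  · rintro h ⟨I, hI, rfl | rfl⟩
    · exact (h I hI).1 rfl
    · exact (h I hI).2 rfl
  · rintro rfl
    exact h ⟨I, hI, Or.inl rfl⟩
  · rintro rfl
    exact h ⟨I, hI, Or.inr rfl⟩

theorem eq_of_common_endpoint {I J : ℝ × ℝ} (hI : I ∈ ℐ.intervals) (hJ : J ∈ ℐ.intervals) {e : ℝ}
    (hIe : I.1 = e ∨ I.2 = e) (hJe : J.1 = e ∨ J.2 = e) : I = J := by
  by_contra hne
  have := ℐ.no_common_endpoint I hI J hJ hne
  rcases hIe with rfl | rfl <;> rcases hJe with h | h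
  · exact this.1 h.symm
  · exact this.2.1 h.symm
  · exact this.2.2.1 h.symm
  · exact this.2.2.2 h.symm

theorem card_arcColours_le_of_endpoint_lt (Q : List ℝ) {a p z : ℝ}
    (h : ∀ y ∈ ℐ.endpoints, a < y → y < z → y < p) :
    (ℐ.arcColours Q (a, z)).card ≤ (ℐ.arcColours Q (a, p)).card := by
  refine Finset.card_le_card fun c hc => ?_
  obtain ⟨I, hI, hIJ, hIc⟩ := ℐ.mem_arcColours.1 hc
  refine ℐ.mem_arcColours.2 ⟨I, hI, ?_, hIc⟩
  refine hIJ.imp (fun hz => ⟨hz.1, h _ ?_ hz.1 hz.2⟩) (fun hz => ⟨hz.1, h _ ?_ hz.1 hz.2⟩)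
  · exact ℐ.mem_endpoints.2 ⟨I, hI, Or.inl rfl⟩
  · exact ℐ.mem_endpoints.2 ⟨I, hI, Or.inr rfl⟩

/-- Passing one endpoint adds at most one colour, as no two intervals share an endpoint. -/
theorem card_arcColours_le_succ (Q : List ℝ) {a e z : ℝ} (he : e ∈ ℐ.endpoints)
    (h : ∀ y ∈ ℐ.endpoints, y < z → y ≤ e) :
    (ℐ.arcColours Q (a, z)).card ≤ (ℐ.arcColours Q (a, e)).card + 1 := by
  obtain ⟨I, hI, hIe⟩ := ℐ.mem_endpoints.1 he
  have hone : (ℐ.colouring Q I).toFinset.card ≤ 1 := by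
    cases ℐ.colouring Q I <;> simp
  refine le_trans ?_ (Nat.add_le_add_left hone _)
  refine (Finset.card_le_card fun c hc => ?_).trans (Finset.card_union_le _ _)
  obtain ⟨J, hJ, hJz, hJc⟩ := ℐ.mem_arcColours.1 hc
  rw [Finset.mem_union]
  by_cases hJe : J.1 = e ∨ J.2 = e
  · obtain rfl := ℐ.eq_of_common_endpoint hI hJ hIe hJe
    exact Or.inr (by simp [hJc])
  · push Not at hJe
    refine Or.inl (ℐ.mem_arcColours.2 ⟨J, hJ, hJz.imp (fun h' => ⟨h'.1, ?_⟩)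
      (fun h' => ⟨h'.1, ?_⟩), hJc⟩)
    · exact lt_of_le_of_ne (h _ (ℐ.mem_endpoints.2 ⟨J, hJ, Or.inl rfl⟩) h'.2) hJe.1
    · exact lt_of_le_of_ne (h _ (ℐ.mem_endpoints.2 ⟨J, hJ, Or.inr rfl⟩) h'.2) hJe.2

theorem exists_endpoint_of_card_pos {Q : List ℝ} {a z : ℝ}
    (h : 0 < (ℐ.arcColours Q (a, z)).card) : ∃ e ∈ ℐ.endpoints, a < e ∧ e < z := by
  obtain ⟨c, hc⟩ := Finset.card_pos.1 h
  obtain ⟨I, hI, h | h, -⟩ := ℐ.mem_arcColours.1 hc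
  · exact ⟨_, ℐ.mem_endpoints.2 ⟨I, hI, Or.inl rfl⟩, h⟩
  · exact ⟨_, ℐ.mem_endpoints.2 ⟨I, hI, Or.inr rfl⟩, h⟩

theorem exists_pillar_card_arcColours_eq {Q : List ℝ} {a b : ℝ} {t : ℕ} (ha : 0 ≤ a)
    (hb : b ≤ 1) (ht : 0 < t) (h : t < (ℐ.arcColours Q (a, b)).card) :
    ∃ p, ℐ.IsPillar p ∧ (ℐ.arcColours Q (a, p)).card = t ∧
      (∃ e ∈ ℐ.endpoints, a < e ∧ e < p) ∧ ∃ e ∈ ℐ.endpoints, p < e ∧ e < b := by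
  classical
  let E := ℐ.endpoints.filter fun e => a < e ∧ e < b
  have hE : E.Nonempty := by
    obtain ⟨e, he, hab⟩ := ℐ.exists_endpoint_of_card_pos (ht.trans h)
    exact ⟨e, Finset.mem_filter.2 ⟨he, hab⟩⟩
  let Z := E.filter fun e => t ≤ (ℐ.arcColours Q (a, e)).card
  have hZ : Z.Nonempty := by
    have hmem := Finset.mem_filter.1 (E.max'_mem hE)
    refine ⟨E.max' hE, Finset.mem_filter.2 ⟨E.max'_mem hE, ?_⟩⟩
    have := ℐ.card_arcColours_le_succ Q (a := a) (z := b) hmem.1 fun y hy hyb => by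
      rcases le_or_gt y a with hya | hya
      · exact hya.trans hmem.2.1.le
      · exact E.le_max' y (Finset.mem_filter.2 ⟨hy, hya, hyb⟩)
    omega
  set e := Z.min' hZ
  obtain ⟨heE, het⟩ := Finset.mem_filter.1 (Z.min'_mem hZ)
  obtain ⟨he, hae, heb⟩ := Finset.mem_filter.1 heE
  let W := ℐ.endpoints.filter fun y => a < y ∧ y < e
  have hW : W.Nonempty := by
    obtain ⟨y, hy, hye⟩ := ℐ.exists_endpoint_of_card_pos (ht.trans_le het)
    exact ⟨y, Finset.mem_filter.2 ⟨hy, hye⟩⟩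
  set d := W.max' hW
  obtain ⟨hd, had, hde⟩ := Finset.mem_filter.1 (W.max'_mem hW)
  have hWd : ∀ y ∈ ℐ.endpoints, y < e → y ≤ d := fun y hy hye => by
    rcases le_or_gt y a with hya | hya
    · exact hya.trans had.le
    · exact W.le_max' y (Finset.mem_filter.2 ⟨hy, hya, hye⟩)
  have hdt : (ℐ.arcColours Q (a, d)).card < t := by
    by_contra! hle
    exact absurd (Z.min'_le d (Finset.mem_filter.2
      ⟨Finset.mem_filter.2 ⟨hd, had, hde.trans heb⟩, hle⟩)) (not_le.2 hde)
  have hed : (ℐ.arcColours Q (a, e)).card ≤ (ℐ.arcColours Q (a, d)).card + 1 :=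
    ℐ.card_arcColours_le_succ Q hd hWd
  have het' : t ≤ (ℐ.arcColours Q (a, e)).card := het
  have hdp : d < (d + e) / 2 := by linarith
  have hpe : (d + e) / 2 < e := by linarith
  have h1 := Finset.card_le_card (ℐ.arcColours_mono Q (J := (a, (d + e) / 2)) (K := (a, e))
    (Set.Ioo_subset_Ioo_right hpe.le))
  have h2 := ℐ.card_arcColours_le_of_endpoint_lt Q (a := a) (p := (d + e) / 2) (z := e)
    fun y hy _ hye => (hWd y hy hye).trans_lt hdp
  refine ⟨(d + e) / 2, ℐ.isPillar_iff.2 ⟨⟨by linarith, by linarith⟩, fun hp => ?_⟩, by omega,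
    ⟨d, hd, had, hdp⟩, ⟨e, he, hpe, heb⟩⟩
  exact absurd (hWd _ hp hpe) (not_le.2 hdp)

/-- Cutting greedily from left to right, each time as soon as `t` colours have been seen. -/
theorem exists_windows {Q : List ℝ} {a b : ℝ} {t : ℕ} (ha : 0 ≤ a) (hb : b ≤ 1) (ht : 0 < t) :
    ∃ X : Finset ℝ, (∀ x ∈ X, ℐ.IsPillar x ∧ (∃ e ∈ ℐ.endpoints, a < e ∧ e < x) ∧
        ∃ e ∈ ℐ.endpoints, x < e ∧ e < b) ∧
      (∀ x ∈ X, ∃ u, a ≤ u ∧ (∀ x' ∈ X, x' ≤ u ∨ x ≤ x') ∧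
        t ≤ (ℐ.arcColours Q (u, x)).card) ∧
      ∀ J : ℝ × ℝ, a ≤ J.1 → J.2 ≤ b → (∀ x ∈ X, x ≤ J.1 ∨ J.2 ≤ x) →
        (ℐ.arcColours Q J).card ≤ t := by
  classical
  induction hN : (ℐ.endpoints.filter fun e => a < e ∧ e < b).card using Nat.strong_induction_on
    generalizing a with
  | _ N ih =>
    subst hN
    rcases le_or_gt (ℐ.arcColours Q (a, b)).card t with hle | hlt
    · refine ⟨∅, by simp, by simp, fun J haJ hJb _ => le_trans ?_ hle⟩
      exact Finset.card_le_card (ℐ.arcColours_mono Q (Set.Ioo_subset_Ioo haJ hJb))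
    · obtain ⟨p, hp, hpt, ⟨d, hd, had, hdp⟩, e, he, hpe, heb⟩ :=
        ℐ.exists_pillar_card_arcColours_eq ha hb ht hlt
      have hap : a < p := had.trans hdp
      obtain ⟨X, hX, hwin, hfew⟩ := ih _ (Finset.card_lt_card
        (s := ℐ.endpoints.filter fun e => p < e ∧ e < b) ⟨fun y hy => by
          simp only [Finset.mem_filter] at hy ⊢
          exact ⟨hy.1, hap.trans hy.2.1, hy.2.2⟩, fun hsub => by
          have := hsub (Finset.mem_filter.2 ⟨hd, had, (hdp.trans hpe).trans heb⟩)
          exact absurd (Finset.mem_filter.1 this).2.1 (not_lt.2 hdp.le)⟩)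
        (a := p) (ha.trans hap.le) rfl
      have hpX : ∀ x ∈ X, p < x := fun x hx => by
        obtain ⟨-, ⟨y, -, hpy, hyx⟩, -⟩ := hX x hx
        exact hpy.trans hyx
      refine ⟨insert p X, fun x hx => ?_, fun x hx => ?_, fun J haJ hJb hJX => ?_⟩
      · rcases Finset.mem_insert.1 hx with rfl | hx
        · exact ⟨hp, ⟨d, hd, had, hdp⟩, e, he, hpe, heb⟩
        · obtain ⟨h1, ⟨y, hy, hpy, hyx⟩, h3⟩ := hX x hx
          exact ⟨h1, ⟨y, hy, hap.trans hpy, hyx⟩, h3⟩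
      · rcases Finset.mem_insert.1 hx with rfl | hx
        · refine ⟨a, le_rfl, fun x' hx' => Or.inr ?_, hpt.ge⟩
          rcases Finset.mem_insert.1 hx' with rfl | hx'
          · exact le_rfl
          · exact (hpX x' hx').le
        · obtain ⟨u, hpu, hu, hut⟩ := hwin x hx
          refine ⟨u, hap.le.trans hpu, fun x' hx' => ?_, hut⟩
          rcases Finset.mem_insert.1 hx' with rfl | hx'
          · exact Or.inl hpu
          · exact hu x' hx'
      · rcases hJX p (Finset.mem_insert_self _ _) with h | h
        · exact hfew J h hJb fun x hx => hJX x (Finset.mem_insert_of_mem hx)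
        · rw [← hpt]
          exact Finset.card_le_card (ℐ.arcColours_mono Q (Set.Ioo_subset_Ioo haJ h))

end IntervalSystem

namespace PillarAssignment

variable {ℐ : IntervalSystem}

/-! ### Completing a pillar assignment -/

theorem exists_isArch_of_not_isComplete {P : PillarAssignment ℐ} {I : ℝ × ℝ}
    (hI : I ∈ ℐ.intervals) (hIP : ∀ p ∈ P.pillars, p ∉ openInterval I) :
    ∃ a b : ℝ, P.IsArch (a, b) ∧ (a = 0 ∨ a ∈ P.pillars) ∧ (b = 1 ∨ b ∈ P.pillars) ∧
      0 ≤ a ∧ a ≤ I.1 ∧ I.2 ≤ b ∧ b ≤ 1 := by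
  classical
  obtain ⟨h0, hlt, h1⟩ := ℐ.mem_unit I hI
  let A := insert 0 (P.pillars.toFinset.filter fun q => q ≤ I.1)
  let B := insert 1 (P.pillars.toFinset.filter fun q => I.2 ≤ q)
  have hA : A.Nonempty := Finset.insert_nonempty _ _
  have hB : B.Nonempty := Finset.insert_nonempty _ _
  have ha : A.max' hA = 0 ∨ A.max' hA ∈ P.pillars ∧ A.max' hA ≤ I.1 := by
    simpa [A] using A.max'_mem hA
  have hb : B.min' hB = 1 ∨ B.min' hB ∈ P.pillars ∧ I.2 ≤ B.min' hB := by
    simpa [B] using B.min'_mem hB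
  have haI : A.max' hA ≤ I.1 := ha.elim (fun h => h.trans_le h0) And.right
  have hIb : I.2 ≤ B.min' hB := hb.elim (fun h => h1.trans_eq h.symm) And.right
  refine ⟨A.max' hA, B.min' hB, ⟨haI.trans_lt (hlt.trans_le hIb), ?_, ?_, ?_⟩,
    ha.imp_right And.left, hb.imp_right And.left, A.le_max' 0 (Finset.mem_insert_self _ _),
    haI, hIb, B.min'_le 1 (Finset.mem_insert_self _ _)⟩
  · exact ha.imp_right fun h => Or.inr h.1
  · exact Or.inr (hb.imp_right And.left)
  · intro q hq hqab
    rcases le_or_gt q I.1 with h | h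
    · exact absurd (A.le_max' q (Finset.mem_insert_of_mem (Finset.mem_filter.2
        ⟨List.mem_toFinset.2 hq, h⟩))) (not_le.2 hqab.1)
    · rcases le_or_gt I.2 q with h' | h'
      · exact absurd (B.min'_le q (Finset.mem_insert_of_mem (Finset.mem_filter.2
          ⟨List.mem_toFinset.2 hq, h'⟩))) (not_le.2 hqab.2)
      · exact hIP q hq ⟨h, h'⟩

/-- An incomplete assignment whose arches have degree at most `D` can be refined, keeping this
property: the new pillars cut an arch into fewer than `2 ^ n` parts with at most `t` old colours
each, and the binary search order adds at most `n` sets of new colours to each part. If no cut is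
needed for this, a single new pillar may be placed anywhere. -/
theorem exists_refinement (P : PillarAssignment ℐ) {ω n t D F : ℕ}
    (hω : (overlapGraph ℐ.intervals).cliqueNum ≤ ω) (hn : 0 < n) (ht : 0 < t)
    (htD : t + n * ω ≤ D) (hDF : D + n * ω ≤ F)
    (hcut : ∀ m : ℕ, m * t ≤ ω * (2 * m + D) → m < 2 ^ n) (hχ : P.χ ≤ F)
    (hdeg : ∀ K, P.IsArch K → P.degree K ≤ D) (hinc : ¬ P.IsComplete) :
    ∃ P' : PillarAssignment ℐ, P.pillars <:+ P'.pillars ∧ P'.χ ≤ F ∧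
      (∀ K, P'.IsArch K → P'.degree K ≤ D) ∧
      ∃ e ∈ ℐ.endpoints, ∃ e' ∈ ℐ.endpoints, (∀ p ∈ P.pillars, ¬ (e < p ∧ p < e')) ∧
        ∃ p ∈ P'.pillars, e < p ∧ p < e' := by
  classical
  have hnw : n * (overlapGraph ℐ.intervals).cliqueNum ≤ n * ω := Nat.mul_le_mul_left _ hω
  unfold IsComplete at hinc
  push Not at hinc
  obtain ⟨I, hI, hIP⟩ := hinc
  obtain ⟨a, b, harch, ha, hb, h0a, haI, hIb, hb1⟩ := exists_isArch_of_not_isComplete hI hIP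
  have hlt := (ℐ.mem_unit I hI).2.1
  have hab : ∀ q ∈ P.pillars, q ∉ Set.Ioo a b := harch.2.2.2
  have hdegab : (ℐ.arcColours P.pillars (a, b)).card ≤ D := hdeg _ harch
  obtain ⟨X, hne, hX, hcard, hfew⟩ : ∃ X : Finset ℝ, X.Nonempty ∧
      (∀ x ∈ X, ℐ.IsPillar x ∧ (∃ e ∈ ℐ.endpoints, a ≤ e ∧ e < x) ∧
        ∃ e ∈ ℐ.endpoints, x < e ∧ e ≤ b) ∧ X.card < 2 ^ n ∧
      ∀ J : ℝ × ℝ, a ≤ J.1 → J.2 ≤ b → (∀ x ∈ X, x ≤ J.1 ∨ J.2 ≤ x) →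
        (ℐ.arcColours P.pillars J).card ≤ t := by
    obtain ⟨X, hX, hwin, hfew⟩ := ℐ.exists_windows (Q := P.pillars) h0a hb1 ht
    rcases X.eq_empty_or_nonempty with rfl | hne
    · obtain ⟨x, hx, hxE⟩ := (Set.Ioo_infinite hlt).exists_notMem_finset ℐ.endpoints
      refine ⟨{x}, Finset.singleton_nonempty x, ?_, ?_, ?_⟩
      · simp only [Finset.mem_singleton, forall_eq]
        refine ⟨ℐ.isPillar_iff.2 ⟨⟨?_, ?_⟩, hxE⟩,
          ⟨I.1, ℐ.mem_endpoints.2 ⟨I, hI, Or.inl rfl⟩, haI, hx.1⟩,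
          I.2, ℐ.mem_endpoints.2 ⟨I, hI, Or.inr rfl⟩, hx.2, hIb⟩
        · exact (h0a.trans haI).trans_lt hx.1
        · exact hx.2.trans_le (hIb.trans hb1)
      · rw [Finset.card_singleton]
        exact Nat.one_lt_two_pow hn.ne'
      · intro J haJ hJb _
        exact hfew J haJ hJb (by simp)
    · refine ⟨X, hne, fun x hx => ?_, ?_, hfew⟩
      · obtain ⟨hp, ⟨e, he, hae, hex⟩, e', he', hxe', he'b⟩ := hX x hx
        exact ⟨hp, ⟨e, he, hae.le, hex⟩, e', he', hxe', he'b.le⟩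
      · refine hcut _ ((ℐ.card_mul_le_of_windows h0a hb1 hab X t fun x hx => ?_).trans
          (Nat.mul_le_mul hω (Nat.add_le_add_left hdegab _)))
        obtain ⟨u, hau, hu, hut⟩ := hwin x hx
        obtain ⟨-, -, e', -, hxe', he'b⟩ := hX x hx
        exact ⟨u, hau, (hxe'.trans he'b).le, hu, hut⟩
  have hXab : ∀ x ∈ X, x ∈ Set.Ioo a b := fun x hx => by
    obtain ⟨-, ⟨e, -, hae, hex⟩, e', -, hxe', he'b⟩ := hX x hx
    exact ⟨hae.trans_lt hex, hxe'.trans_le he'b⟩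
  obtain ⟨L, hL, hmem, hcol, hin, hout⟩ := ℐ.exists_list_of_card_lt_two_pow (F := F) ha hb hXab
    hcard (by omega) hχ
  refine ⟨⟨L ++ P.pillars, ?_, ?_⟩, List.suffix_append _ _, hcol, ?_, ?_⟩
  · refine List.nodup_append.2 ⟨hL, P.nodup, ?_⟩
    rintro x hx y hy rfl
    exact hab x hy (hXab x ((hmem x).1 hx))
  · intro p hp
    rcases List.mem_append.1 hp with hp | hp
    · exact (hX p ((hmem p).1 hp)).1
    · exact P.isPillar p hp
  · rintro K ⟨hK, hK1, hK2, hKP⟩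
    change (ℐ.arcColours (L ++ P.pillars) K).card ≤ D
    simp only [List.mem_append] at hK1 hK2 hKP
    have hunit : ∀ p, p = 0 ∨ p = 1 ∨ p ∈ L ∨ p ∈ P.pillars → 0 ≤ p ∧ p ≤ 1 := by
      rintro p (rfl | rfl | hp | hp)
      · simp
      · simp
      · have := (hX p ((hmem p).1 hp)).1.1
        exact ⟨this.1.le, this.2.le⟩
      · have := (P.isPillar p hp).1
        exact ⟨this.1.le, this.2.le⟩
    have haK : a ≤ K.1 ∨ K.2 ≤ a := by
      rcases ha with rfl | ha
      · exact Or.inl (hunit _ hK1).1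
      · by_contra! h
        exact hKP a (Or.inr ha) h
    have hbK : b ≤ K.1 ∨ K.2 ≤ b := by
      rcases hb with rfl | hb
      · exact Or.inr (hunit _ hK2).2
      · by_contra! h
        exact hKP b (Or.inr hb) h
    have houtside : K.2 ≤ a ∨ b ≤ K.1 → (ℐ.arcColours (L ++ P.pillars) K).card ≤ D := by
      intro h
      have hold : ∀ p, p = K.1 ∨ p = K.2 → p ∉ L := by
        intro p hp hpL
        have hpab := hXab p ((hmem p).1 hpL)
        have h1 := hpab.1
        have h2 := hpab.2
        rcases hp with rfl | rfl <;> rcases h with h | h <;> linarith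
      have hKarch : P.IsArch K := by
        refine ⟨hK, hK1.imp_right (Or.imp_right fun h' => ?_),
          hK2.imp_right (Or.imp_right fun h' => ?_), fun p hp => hKP p (Or.inr hp)⟩
        · exact h'.resolve_left (hold _ (Or.inl rfl))
        · exact h'.resolve_left (hold _ (Or.inr rfl))
      exact (Finset.card_le_card (hout K h)).trans (hdeg K hKarch)
    rcases haK with haK | haK
    · rcases hbK with hbK | hbK
      · exact houtside (Or.inr hbK)
      · have hKX : ∀ x ∈ X, x ≤ K.1 ∨ K.2 ≤ x := fun x hx => by
          by_contra! h
          exact hKP x (Or.inl ((hmem x).2 hx)) h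
        have h1 := hin K haK hbK hKX
        have h2 := hfew K haK hbK hKX
        omega
    · exact houtside (Or.inl haK)
  · obtain ⟨x, hx⟩ := hne
    obtain ⟨-, ⟨e, he, hae, hex⟩, e', he', hxe', he'b⟩ := hX x hx
    refine ⟨e, he, e', he', fun p hp h => hab p hp ⟨hae.trans_lt h.1, h.2.trans_le he'b⟩,
      x, ?_, hex, hxe'⟩
    exact List.mem_append_left _ ((hmem x).2 hx)

theorem exists_complete (P : PillarAssignment ℐ) {ω n t D F : ℕ}
    (hω : (overlapGraph ℐ.intervals).cliqueNum ≤ ω) (hn : 0 < n) (ht : 0 < t)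
    (htD : t + n * ω ≤ D) (hDF : D + n * ω ≤ F)
    (hcut : ∀ m : ℕ, m * t ≤ ω * (2 * m + D) → m < 2 ^ n) (hχ : P.χ ≤ F)
    (hdeg : ∀ K, P.IsArch K → P.degree K ≤ D) :
    ∃ P' : PillarAssignment ℐ, P'.IsComplete ∧ P.pillars <:+ P'.pillars ∧ P'.χ ≤ F := by
  classical
  -- Every refinement separates a pair of endpoints that had no pillar in between.
  induction hN : ((ℐ.endpoints ×ˢ ℐ.endpoints).filter fun e =>
    ∀ p ∈ P.pillars, ¬ (e.1 < p ∧ p < e.2)).card using Nat.strong_induction_on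
    generalizing P with
  | _ N ih =>
    subst hN
    by_cases hc : P.IsComplete
    · exact ⟨P, hc, List.suffix_rfl, hχ⟩
    · obtain ⟨P', hsuf, hχ', hdeg', e, he, e', he', hsep, p, hp, hep⟩ :=
        P.exists_refinement hω hn ht htD hDF hcut hχ hdeg hc
      obtain ⟨P'', hP'', hsuf', hχ''⟩ := ih _ (Finset.card_lt_card ⟨fun s hs => by
          simp only [Finset.mem_filter] at hs ⊢
          exact ⟨hs.1, fun q hq => hs.2 q (hsuf.subset hq)⟩, fun hsub => by
          have := hsub (x := (e, e')) (Finset.mem_filter.2 ⟨Finset.mk_mem_product he he', hsep⟩)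
          exact (Finset.mem_filter.1 this).2 p hp hep⟩) P' hχ' hdeg' rfl
      exact ⟨P'', hP'', hsuf.trans hsuf', hχ''⟩

theorem extends_of_suffix {P P' : PillarAssignment ℐ} (h : P.pillars <:+ P'.pillars) :
    P'.Extends P :=
  ⟨h, ℐ.isProperPartialColouring_colouring _,
    fun _ _ _ hc => ℐ.colouring_eq_some_of_suffix h hc⟩

end PillarAssignment

/-! ### The numerical bounds -/

theorem logb_two_le {x : ℝ} (hx : 1 ≤ x) : Real.logb 2 x ≤ 1.4428 * (x - 1) := by
  have h1 := Real.log_le_sub_one_of_pos (zero_lt_one.trans_le hx)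
  have h2 := Real.log_two_gt_d9
  rw [Real.logb, div_le_iff₀ (by linarith)]
  nlinarith

theorem colourBound_eq (ω : ℕ) : colourBound ω = 2 * degreeBound ω - 2 * ω := by
  rw [colourBound, degreeBound]
  ring

theorem degreeBound_eq (ω : ℕ) :
    degreeBound ω = ω * (Real.logb 2 ω + Real.logb 2 (Real.logb 2 ω) + 6) := by
  rw [degreeBound]
  ring

theorem one_le_logb_two {ω : ℕ} (hω : 2 ≤ ω) : 1 ≤ Real.logb 2 ω := by
  rw [Real.le_logb_iff_rpow_le (by norm_num) (by positivity), Real.rpow_one]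
  exact_mod_cast hω

theorem colourBound_isBigO :
    colourBound =O[Filter.atTop] fun ω : ℕ => (ω : ℝ) * Real.logb 2 (ω : ℝ) := by
  refine Asymptotics.IsBigO.of_bound 16 (Filter.eventually_atTop.2 ⟨2, fun ω hω => ?_⟩)
  have hL := one_le_logb_two hω
  have hl := logb_two_le hL
  have hl0 := Real.logb_nonneg (b := 2) (by norm_num) hL
  have hω0 : (0 : ℝ) ≤ ω := ω.cast_nonneg
  rw [Real.norm_of_nonneg (by rw [colourBound]; positivity),
    Real.norm_of_nonneg (mul_nonneg hω0 (by linarith)), colourBound]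
  have : (ω : ℝ) * (2 * Real.logb 2 ω + 2 * Real.logb 2 (Real.logb 2 ω) + 10) ≤
      ω * (16 * Real.logb 2 ω) := mul_le_mul_of_nonneg_left (by linarith) hω0
  linarith

theorem le_logb_two_of_three_le {ω : ℕ} (hω : 3 ≤ ω) : (19 / 12 : ℝ) ≤ Real.logb 2 ω := by
  have h3 : (19 / 12 : ℝ) ≤ Real.logb 2 3 := by
    rw [div_le_iff₀' (by norm_num), show (12 : ℝ) * Real.logb 2 3 = Real.logb 2 (3 ^ 12) by
      rw [Real.logb_pow]; norm_num, Real.le_logb_iff_rpow_le (by norm_num) (by norm_num)]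
    norm_num
  exact h3.trans (Real.logb_le_logb_of_le (by norm_num) (by norm_num) (by exact_mod_cast hω))

/-- Write `degreeBound ω = ω * X`. The number `n` is `⌊X⌋ - 3` and `t` is what remains of the degree
bound after `n` rounds. As `2 ^ X = 64 * ω * logb 2 ω`, the bound on the number `m` of windows
amounts to `X` being at most about `8 * logb 2 ω`; for `ω = 2` the values are exact. -/
theorem exists_parameters {ω : ℕ} (hω : 2 ≤ ω) : ∃ n t : ℕ, 0 < n ∧ 0 < t ∧
    t + n * ω ≤ ⌊degreeBound ω⌋₊ ∧ ⌊degreeBound ω⌋₊ + n * ω ≤ ⌊colourBound ω⌋₊ ∧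
    ∀ m : ℕ, m * t ≤ ω * (2 * m + ⌊degreeBound ω⌋₊) → m < 2 ^ n := by
  rcases hω.eq_or_lt with rfl | hω
  · have hD : degreeBound 2 = (14 : ℕ) := by
      rw [degreeBound_eq]
      norm_num
    have hf : colourBound 2 = (24 : ℕ) := by
      rw [colourBound_eq, hD]
      norm_num
    rw [hD, hf, Nat.floor_natCast, Nat.floor_natCast]
    exact ⟨4, 6, by norm_num, by norm_num, by norm_num, by norm_num, fun m hm => by omega⟩
  set L := Real.logb 2 ω with hLdef
  set X := L + Real.logb 2 L + 6 with hXdef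
  have hDX : degreeBound ω = ω * X := degreeBound_eq ω
  have hω3 : (3 : ℝ) ≤ ω := by exact_mod_cast hω
  have hL : 19 / 12 ≤ L := le_logb_two_of_three_le hω
  have hl := logb_two_le (x := L) (by linarith)
  have hl0 := Real.logb_nonneg (b := 2) (x := L) (by norm_num) (by linarith)
  have hX0 : 7 ≤ X := by linarith
  have hN : 7 ≤ ⌊X⌋₊ := Nat.le_floor (by exact_mod_cast hX0)
  obtain ⟨n, hn⟩ : ∃ n, ⌊X⌋₊ = n + 3 := ⟨⌊X⌋₊ - 3, by omega⟩
  have hnX : (n : ℝ) + 3 ≤ X := by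
    have := Nat.floor_le (show 0 ≤ X by linarith)
    rw [hn] at this
    exact_mod_cast this
  have hXn : X < n + 4 := by
    have := Nat.lt_floor_add_one X
    rw [hn] at this
    push_cast at this
    linarith
  set D := ⌊degreeBound ω⌋₊
  have hDle : (D : ℝ) ≤ ω * X := by
    rw [← hDX]
    exact Nat.floor_le (by rw [hDX]; positivity)
  have hDgt : ω * X < D + 1 := by
    rw [← hDX]
    exact Nat.lt_floor_add_one _
  have hnD : n * ω + 2 * ω ≤ D := by
    refine Nat.le_floor ?_
    rw [hDX]
    push_cast
    nlinarith
  obtain ⟨s, hs⟩ := Nat.exists_eq_add_of_le hnD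
  -- `x` lies in `[1, 2)`.
  set x := X - n - 2 with hx
  have hs_gt : ω * x - 1 < s := by
    have : (D : ℝ) = n * ω + 2 * ω + s := by exact_mod_cast hs
    rw [hx]
    linarith
  refine ⟨n, 2 * ω + s, by omega, by omega, by omega, ?_, fun m hm => ?_⟩
  · refine Nat.le_floor ?_
    rw [colourBound_eq, hDX]
    push_cast
    nlinarith
  · have hms : m * s ≤ ω * D := by nlinarith
    have hms' : (m : ℝ) * s ≤ ω * (ω * X) := by
      calc (m : ℝ) * s ≤ ω * D := by exact_mod_cast hms
        _ ≤ _ := by gcongr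
    by_contra! hm2
    have hm2' : (2 : ℝ) ^ n ≤ m := by exact_mod_cast hm2
    have hpow : (8 : ℝ) * ω * L ≤ 2 ^ n * x := by
      have h1 : (2 : ℝ) ^ X = 64 * ω * L := by
        rw [hXdef, Real.rpow_add (by norm_num), Real.rpow_add (by norm_num), hLdef,
          Real.rpow_logb (by norm_num) (by norm_num) (by linarith), ← hLdef,
          Real.rpow_logb (by norm_num) (by norm_num) (by linarith)]
        norm_num
        ring
      have h2 : (2 : ℝ) ^ X = 2 ^ n * 8 * 2 ^ (x - 1) := by
        rw [show X = n + 3 + (x - 1) by rw [hx]; ring, Real.rpow_add (by norm_num),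
          Real.rpow_add (by norm_num), Real.rpow_natCast]
        norm_num
      -- Bernoulli's inequality bounds the loss from rounding `X` down.
      have h3 : (2 : ℝ) ^ (x - 1) ≤ x := by
        have := rpow_one_add_le_one_add_mul_self (s := 1) (by norm_num) (p := x - 1)
          (by linarith) (by linarith)
        norm_num at this
        exact this
      have h4 : (2 : ℝ) ^ n * 8 * 2 ^ (x - 1) ≤ 2 ^ n * 8 * x := by gcongr
      linarith
    have hx1 : 1 ≤ x := by linarith
    have hsmall : 8 * L ≤ ω * (8 * L - X) := by
      have : 3 * (8 * L - X) ≤ ω * (8 * L - X) :=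
        mul_le_mul_of_nonneg_right hω3 (by linarith)
      linarith
    have hkey : (2 : ℝ) ^ n * (ω * x - 1) ≥ ω * (ω * X) := by
      have h5 : (8 * ω * L) * (ω - 1) ≤ 2 ^ n * x * (ω - 1) :=
        mul_le_mul_of_nonneg_right hpow (by linarith)
      have h6 : ω * (8 * L) ≤ ω * (ω * (8 * L - X)) := by gcongr
      have h9 : 0 ≤ (2 : ℝ) ^ n * (x - 1) := mul_nonneg (by positivity) (by linarith)
      linarith
    have : (2 : ℝ) ^ n * (ω * x - 1) < m * s := by
      have hpos : (0 : ℝ) < 2 ^ n := by positivity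
      have h7 : (2 : ℝ) ^ n * (ω * x - 1) < 2 ^ n * s := by gcongr
      have h8 : (2 : ℝ) ^ n * s ≤ m * s := by gcongr
      linarith
    linarith

/-! ### Chords and angles -/

/-- Twice the signed area of the triangle `a b p`, which tells on which side of the line through `a`
and `b` the point `p` lies. -/
def lineSide (a b p : ℂ) : ℝ := (b.re - a.re) * (p.im - a.im) - (b.im - a.im) * (p.re - a.re)

theorem lineSide_combination (a b c d : ℂ) {s t : ℝ} (h : s + t = 1) :
    lineSide a b (s • c + t • d) = s * lineSide a b c + t * lineSide a b d := by
  simp only [lineSide, Complex.add_re, Complex.add_im, Complex.real_smul, Complex.mul_re,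
    Complex.mul_im, Complex.ofReal_re, Complex.ofReal_im]
  linear_combination ((b.re - a.re) * a.im - (b.im - a.im) * a.re) * h

theorem Circle.re_eq_cos_arg (z : Circle) : (z : ℂ).re = Real.cos (z : ℂ).arg := by
  rw [Complex.cos_arg (Circle.coe_ne_zero z), Circle.norm_coe, div_one]

theorem Circle.im_eq_sin_arg (z : Circle) : (z : ℂ).im = Real.sin (z : ℂ).arg := by
  rw [Complex.sin_arg, Circle.norm_coe, div_one]

theorem lineSide_circle (a b c : Circle) : lineSide a b c =
    -4 * Real.sin (((b : ℂ).arg - (a : ℂ).arg) / 2) * Real.sin (((b : ℂ).arg - (c : ℂ).arg) / 2) *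
      Real.sin (((c : ℂ).arg - (a : ℂ).arg) / 2) := by
  simp only [lineSide, Circle.re_eq_cos_arg, Circle.im_eq_sin_arg]
  generalize (a : ℂ).arg = α
  generalize (b : ℂ).arg = β
  generalize (c : ℂ).arg = θ
  obtain ⟨p, rfl⟩ : ∃ p, β = α + 2 * p := ⟨(β - α) / 2, by ring⟩
  obtain ⟨q, rfl⟩ : ∃ q, θ = α + 2 * p + 2 * q := ⟨(θ - (α + 2 * p)) / 2, by ring⟩
  rw [show (α + 2 * p - α) / 2 = p by ring, show (α + 2 * p - (α + 2 * p + 2 * q)) / 2 = -q by ring,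
    show (α + 2 * p + 2 * q - α) / 2 = p + q by ring, Real.sin_neg]
  have hsum : (Real.cos (α + 2 * p) - Real.cos α) * (Real.sin (α + 2 * p + 2 * q) - Real.sin α) -
      (Real.sin (α + 2 * p) - Real.sin α) * (Real.cos (α + 2 * p + 2 * q) - Real.cos α) =
      Real.sin (α + 2 * p + 2 * q - (α + 2 * p)) + Real.sin (α + 2 * p - α) +
        Real.sin (α - (α + 2 * p + 2 * q)) := by
    rw [Real.sin_sub, Real.sin_sub, Real.sin_sub]
    ring
  rw [hsum, show α + 2 * p + 2 * q - (α + 2 * p) = 2 * q by ring,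
    show α + 2 * p - α = 2 * p by ring, show α - (α + 2 * p + 2 * q) = -(2 * p + 2 * q) by ring,
    Real.sin_neg, Real.sin_add, Real.sin_add, Real.sin_two_mul, Real.sin_two_mul, Real.cos_two_mul,
    Real.cos_two_mul]
  linear_combination (-4 * Real.sin p * Real.cos p) * Real.sin_sq_add_cos_sq q -
    (4 * Real.sin q * Real.cos q) * Real.sin_sq_add_cos_sq p

theorem sin_half_sub_pos {a b : Circle} (h : (a : ℂ).arg < (b : ℂ).arg) :
    0 < Real.sin (((b : ℂ).arg - (a : ℂ).arg) / 2) := by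
  have h1 := Complex.neg_pi_lt_arg (a : ℂ)
  have h2 := Complex.arg_le_pi (b : ℂ)
  exact Real.sin_pos_of_pos_of_lt_pi (by linarith) (by linarith)

theorem sin_half_sub_neg {a b : Circle} (h : (b : ℂ).arg < (a : ℂ).arg) :
    Real.sin (((b : ℂ).arg - (a : ℂ).arg) / 2) < 0 := by
  rw [show ((b : ℂ).arg - (a : ℂ).arg) / 2 = -(((a : ℂ).arg - (b : ℂ).arg) / 2) by ring,
    Real.sin_neg]
  exact neg_neg_of_pos (sin_half_sub_pos h)

theorem lineSide_neg_of_between {a b c : Circle} (h1 : (a : ℂ).arg < (c : ℂ).arg)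
    (h2 : (c : ℂ).arg < (b : ℂ).arg) : lineSide a b c < 0 := by
  rw [lineSide_circle]
  have := mul_pos (mul_pos (sin_half_sub_pos (h1.trans h2)) (sin_half_sub_pos h2))
    (sin_half_sub_pos h1)
  linarith

theorem lineSide_pos_of_outside {a b c : Circle} (h : (a : ℂ).arg < (b : ℂ).arg)
    (hc : (c : ℂ).arg < (a : ℂ).arg ∨ (b : ℂ).arg < (c : ℂ).arg) : 0 < lineSide a b c := by
  rw [lineSide_circle]
  rcases hc with hc | hc
  · have := mul_neg_of_pos_of_neg (mul_pos (sin_half_sub_pos h) (sin_half_sub_pos (hc.trans h)))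
      (sin_half_sub_neg hc)
    linarith
  · have := mul_neg_of_neg_of_pos (mul_neg_of_pos_of_neg (sin_half_sub_pos h)
      (sin_half_sub_neg hc)) (sin_half_sub_pos (h.trans hc))
    linarith

theorem lineSide_eq_zero_of_mem_segment {a b p : ℂ} (hp : p ∈ segment ℝ a b) :
    lineSide a b p = 0 := by
  obtain ⟨s, t, -, -, hst, rfl⟩ := hp
  rw [lineSide_combination a b a b hst, lineSide, lineSide]
  ring

/-- A point of the closed disc on the line through two points of the circle lies between them. -/
theorem mem_segment_of_lineSide_eq_zero {a b : Circle} (hab : a ≠ b) {p : ℂ}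
    (hp : lineSide a b p = 0) (hp1 : ‖p‖ ≤ 1) : p ∈ segment ℝ (a : ℂ) (b : ℂ) := by
  have ha : (a : ℂ).re * (a : ℂ).re + (a : ℂ).im * (a : ℂ).im = 1 := by
    rw [← Complex.normSq_apply, Circle.normSq_coe]
  have hb : (b : ℂ).re * (b : ℂ).re + (b : ℂ).im * (b : ℂ).im = 1 := by
    rw [← Complex.normSq_apply, Circle.normSq_coe]
  have hpp : p.re * p.re + p.im * p.im ≤ 1 := by
    rw [← Complex.normSq_apply, Complex.normSq_eq_norm_sq]
    exact pow_le_one₀ (norm_nonneg p) hp1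
  have hne : (a : ℂ) ≠ b := fun h => hab (Circle.ext h)
  have hN : 0 < ((b : ℂ).re - (a : ℂ).re) ^ 2 + ((b : ℂ).im - (a : ℂ).im) ^ 2 := by
    by_contra! h
    have h1 := sq_nonneg ((b : ℂ).re - (a : ℂ).re)
    have h2 := sq_nonneg ((b : ℂ).im - (a : ℂ).im)
    have h3 : (b : ℂ).re - (a : ℂ).re = 0 := sq_eq_zero_iff.1 (by linarith)
    have h4 : (b : ℂ).im - (a : ℂ).im = 0 := sq_eq_zero_iff.1 (by linarith)
    exact hne (Complex.ext (by linarith) (by linarith))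
  rw [segment_eq_image_lineMap]
  unfold lineSide at hp
  generalize hax : (a : ℂ).re = ax at *
  generalize hay : (a : ℂ).im = ay at *
  generalize hbx : (b : ℂ).re = bx at *
  generalize hby : (b : ℂ).im = by' at *
  set N := (bx - ax) ^ 2 + (by' - ay) ^ 2 with hNdef
  set r := ((bx - ax) * (p.re - ax) + (by' - ay) * (p.im - ay)) / N with hr
  have hrN : r * N = (bx - ax) * (p.re - ax) + (by' - ay) * (p.im - ay) :=
    div_mul_cancel₀ _ hN.ne'
  have hx : p.re - ax = r * (bx - ax) := by
    apply mul_right_cancel₀ hN.ne'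
    linear_combination (-(by' - ay)) * hp - (bx - ax) * hrN
  have hy : p.im - ay = r * (by' - ay) := by
    apply mul_right_cancel₀ hN.ne'
    linear_combination (bx - ax) * hp - (by' - ay) * hrN
  have hr1 : r * r * N ≤ r * N := by
    have h1 : p.re = ax + r * (bx - ax) := by linarith
    have h2 : p.im = ay + r * (by' - ay) := by linarith
    have h3 : p.re * p.re + p.im * p.im = 1 - r * N + r * r * N := by
      rw [h1, h2, hNdef]
      linear_combination (1 - r) * ha + r * hb
    linarith
  have hr2 : r * r ≤ r := le_of_mul_le_mul_right hr1 hN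
  refine ⟨r, ⟨by nlinarith, by nlinarith⟩, ?_⟩
  apply Complex.ext
  · simp [AffineMap.lineMap_apply, hax, hbx]
    linarith
  · simp [AffineMap.lineMap_apply, hay, hby]
    linarith

theorem segment_inter_segment_nonempty {a b c d : Circle} (hab : (a : ℂ).arg < (b : ℂ).arg)
    (h1 : (a : ℂ).arg ≤ (c : ℂ).arg) (h2 : (c : ℂ).arg ≤ (b : ℂ).arg)
    (h3 : (b : ℂ).arg ≤ (d : ℂ).arg) :
    (segment ℝ (a : ℂ) b ∩ segment ℝ (c : ℂ) d).Nonempty := by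
  have harg : ∀ z w : Circle, (z : ℂ).arg = (w : ℂ).arg → z = w := fun z w h =>
    Circle.injective_arg h
  rcases h1.eq_or_lt with h1 | h1
  · obtain rfl := harg _ _ h1
    exact ⟨a, left_mem_segment _ _ _, left_mem_segment _ _ _⟩
  rcases h2.eq_or_lt with h2 | h2
  · obtain rfl := harg _ _ h2
    exact ⟨c, right_mem_segment _ _ _, left_mem_segment _ _ _⟩
  rcases h3.eq_or_lt with h3 | h3
  · obtain rfl := harg _ _ h3
    exact ⟨b, right_mem_segment _ _ _, right_mem_segment _ _ _⟩
  have hc := lineSide_neg_of_between h1 h2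
  have hd := lineSide_pos_of_outside hab (Or.inr h3)
  set S := lineSide a b c
  set T := lineSide a b d
  have hTS : 0 < T - S := by linarith
  have hst : T / (T - S) + -S / (T - S) = 1 := by
    field_simp
    ring
  have hs : 0 ≤ T / (T - S) := div_nonneg hd.le hTS.le
  have ht : 0 ≤ -S / (T - S) := div_nonneg (by linarith) hTS.le
  refine ⟨(T / (T - S)) • (c : ℂ) + (-S / (T - S)) • (d : ℂ), ?_, ⟨_, _, hs, ht, hst, rfl⟩⟩
  refine mem_segment_of_lineSide_eq_zero (fun h => hab.ne (by rw [h])) ?_ ?_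
  · rw [lineSide_combination _ _ _ _ hst]
    change T / (T - S) * S + -S / (T - S) * T = 0
    ring
  · refine (norm_add_le _ _).trans ?_
    rw [norm_smul, norm_smul, Circle.norm_coe, Circle.norm_coe, Real.norm_of_nonneg hs,
      Real.norm_of_nonneg ht, mul_one, mul_one, hst]

theorem interleave_of_segment_inter_segment_nonempty {a b c d : Circle}
    (hab : (a : ℂ).arg < (b : ℂ).arg) (hcd : (c : ℂ).arg < (d : ℂ).arg)
    (h : (segment ℝ (a : ℂ) b ∩ segment ℝ (c : ℂ) d).Nonempty) :
    ((a : ℂ).arg ≤ (c : ℂ).arg ∧ (c : ℂ).arg ≤ (b : ℂ).arg ∧ (b : ℂ).arg ≤ (d : ℂ).arg) ∨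
      ((c : ℂ).arg ≤ (a : ℂ).arg ∧ (a : ℂ).arg ≤ (d : ℂ).arg ∧ (d : ℂ).arg ≤ (b : ℂ).arg) := by
  obtain ⟨p, hp, s, t, hs, ht, hst, rfl⟩ := h
  have h0 := lineSide_eq_zero_of_mem_segment hp
  rw [lineSide_combination _ _ _ _ hst] at h0
  -- Not both endpoints of the second chord are strictly on the same side of the first one.
  have hneg : ¬ (lineSide a b c < 0 ∧ lineSide a b d < 0) := by
    rintro ⟨h1, h2⟩
    rcases hs.eq_or_lt with rfl | hs
    · obtain rfl : t = 1 := by linarith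
      linarith
    · have := mul_neg_of_pos_of_neg hs h1
      have := mul_nonpos_of_nonneg_of_nonpos ht h2.le
      linarith
  have hpos : ¬ (0 < lineSide a b c ∧ 0 < lineSide a b d) := by
    rintro ⟨h1, h2⟩
    rcases hs.eq_or_lt with rfl | hs
    · obtain rfl : t = 1 := by linarith
      linarith
    · have := mul_pos hs h1
      have := mul_nonneg ht h2.le
      linarith
  rcases lt_or_ge (c : ℂ).arg (a : ℂ).arg with hca | hac
  · have hc := lineSide_pos_of_outside hab (Or.inl hca)
    refine Or.inr ⟨hca.le, ?_, ?_⟩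
    · by_contra! hd
      exact hpos ⟨hc, lineSide_pos_of_outside hab (Or.inl hd)⟩
    · by_contra! hd
      exact hpos ⟨hc, lineSide_pos_of_outside hab (Or.inr hd)⟩
  · have hcb : (c : ℂ).arg ≤ (b : ℂ).arg := by
      by_contra! hbc
      exact hpos ⟨lineSide_pos_of_outside hab (Or.inr hbc),
        lineSide_pos_of_outside hab (Or.inr (hbc.trans hcd))⟩
    rcases le_or_gt (b : ℂ).arg (d : ℂ).arg with hbd | hdb
    · exact Or.inl ⟨hac, hcb, hbd⟩
    · rcases hac.eq_or_lt with hac | hac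
      · exact Or.inr ⟨hac.ge, hac.le.trans hcd.le, hdb.le⟩
      · exact absurd ⟨lineSide_neg_of_between hac (hcd.trans hdb),
          lineSide_neg_of_between (hac.trans hcd) hdb⟩ hneg

theorem IsCircleGraph.exists_angles {V : Type*} {G : SimpleGraph V} (hG : IsCircleGraph G) :
    ∃ lo hi : V → ℝ, (∀ v, lo v < hi v) ∧ ∀ u v, G.Adj u v ↔ u ≠ v ∧
      ((lo u ≤ lo v ∧ lo v ≤ hi u ∧ hi u ≤ hi v) ∨
        (lo v ≤ lo u ∧ lo u ≤ hi v ∧ hi v ≤ hi u)) := by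
  obtain ⟨a, b, hab, hadj⟩ := hG
  have hex : ∀ v, ∃ c d : Circle, (c : ℂ).arg < (d : ℂ).arg ∧
      segment ℝ (a v : ℂ) (b v) = segment ℝ (c : ℂ) d := by
    intro v
    rcases lt_trichotomy (a v : ℂ).arg (b v : ℂ).arg with h | h | h
    · exact ⟨a v, b v, h, rfl⟩
    · exact absurd (Circle.injective_arg h) (hab v)
    · exact ⟨b v, a v, h, segment_symm _ _ _⟩
  choose c d hcd hseg using hex
  refine ⟨fun v => (c v : ℂ).arg, fun v => (d v : ℂ).arg, hcd, fun u v => ?_⟩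
  rw [hadj, hseg, hseg]
  refine and_congr_right fun _ => ⟨interleave_of_segment_inter_segment_nonempty (hcd u) (hcd v), ?_⟩
  rintro (⟨h1, h2, h3⟩ | ⟨h1, h2, h3⟩)
  · exact segment_inter_segment_nonempty (hcd u) h1 h2 h3
  · rw [Set.inter_comm]
    exact segment_inter_segment_nonempty (hcd v) h1 h2 h3

/-! ### From circle graphs to interval systems -/

theorem Finset.exists_strictMonoOn_unit {κ : Type*} [LinearOrder κ] (S : Finset κ) :
    ∃ ρ : κ → ℝ, StrictMonoOn ρ S ∧ ∀ k, 0 ≤ ρ k ∧ ρ k ≤ 1 := by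
  refine ⟨fun k => (S.filter (· < k)).card / S.card, fun k hk l _ hkl => ?_, fun k => ⟨?_, ?_⟩⟩
  · have hpos : (0 : ℝ) < S.card := by exact_mod_cast Finset.card_pos.2 ⟨k, hk⟩
    refine div_lt_div_of_pos_right ?_ hpos
    have : S.filter (· < k) ⊂ S.filter (· < l) := by
      refine ⟨fun x hx => ?_, fun hsub => ?_⟩
      · simp only [Finset.mem_filter] at hx ⊢
        exact ⟨hx.1, hx.2.trans hkl⟩
      · exact lt_irrefl _ (Finset.mem_filter.1 (hsub (Finset.mem_filter.2 ⟨hk, hkl⟩))).2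
    exact_mod_cast Finset.card_lt_card this
  · positivity
  · refine div_le_one_of_le₀ ?_ (Nat.cast_nonneg _)
    exact_mod_cast Finset.card_filter_le _ _

theorem overlap_iff {I J : ℝ × ℝ} : Overlap I J ↔
    (I.1 < J.1 ∧ J.1 < I.2 ∧ I.2 < J.2) ∨ (J.1 < I.1 ∧ I.1 < J.2 ∧ J.2 < I.2) := by
  constructor
  · intro h
    obtain ⟨z, hzI, hzJ⟩ := h.1
    rcases h.strictlyBefore_or with h' | h'
    · exact Or.inl ⟨h'.1, hzJ.1.trans hzI.2, h'.2⟩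
    · exact Or.inr ⟨h'.1, hzI.1.trans hzJ.2, h'.2⟩
  · have key : ∀ I J : ℝ × ℝ, I.1 < J.1 ∧ J.1 < I.2 ∧ I.2 < J.2 → Overlap I J := by
      rintro I J ⟨h1, h2, h3⟩
      exact StrictlyBefore.overlap (z := (J.1 + I.2) / 2) ⟨h1, h3⟩
        ⟨by linarith, by linarith⟩ ⟨by linarith, by linarith⟩
    rintro (h | h)
    · exact key I J h
    · exact (key J I h).symm

/-- Chords sharing an endpoint intersect, so coinciding endpoints have to be separated in a way that
makes the intervals overlap: at each point left endpoints come before right endpoints, and endpoints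
of the same kind are sorted like the opposite endpoints. -/
theorem exists_distinct_endpoints {V : Type*} [Finite V] {lo hi : V → ℝ}
    (hlt : ∀ v, lo v < hi v) : ∃ l r : V → ℝ, (∀ v, 0 ≤ l v ∧ l v < r v ∧ r v ≤ 1) ∧
      (∀ u v, u ≠ v → l u ≠ l v ∧ l u ≠ r v ∧ r u ≠ l v ∧ r u ≠ r v) ∧
      ∀ u v, u ≠ v → (Overlap (l u, r u) (l v, r v) ↔
        (lo u ≤ lo v ∧ lo v ≤ hi u ∧ hi u ≤ hi v) ∨
          (lo v ≤ lo u ∧ lo u ≤ hi v ∧ hi v ≤ hi u)) := by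
  classical
  have : Fintype V := Fintype.ofFinite V
  let idx : V → ℕ := fun v => (Fintype.equivFin V v : ℕ)
  have hidx : Function.Injective idx :=
    Fin.val_injective.comp (Fintype.equivFin V).injective
  let kl : V → ℝ ×ₗ ℕ ×ₗ ℝ ×ₗ ℕ := fun v => toLex (lo v, toLex (0, toLex (hi v, idx v)))
  let kr : V → ℝ ×ₗ ℕ ×ₗ ℝ ×ₗ ℕ := fun v => toLex (hi v, toLex (1, toLex (lo v, idx v)))
  have hll : ∀ u v, kl u < kl v ↔
      lo u < lo v ∨ lo u = lo v ∧ (hi u < hi v ∨ hi u = hi v ∧ idx u < idx v) := fun u v => by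
    simp [kl, Prod.Lex.toLex_lt_toLex]
  have hrr : ∀ u v, kr u < kr v ↔
      hi u < hi v ∨ hi u = hi v ∧ (lo u < lo v ∨ lo u = lo v ∧ idx u < idx v) := fun u v => by
    simp [kr, Prod.Lex.toLex_lt_toLex]
  have hlr : ∀ u v, kl u < kr v ↔ lo u ≤ hi v := fun u v => by
    simp [kl, kr, Prod.Lex.toLex_lt_toLex, le_iff_lt_or_eq]
  obtain ⟨ρ, hρ, hunit⟩ := (Finset.univ.image kl ∪ Finset.univ.image kr).exists_strictMonoOn_unit
  have hkl : ∀ v, kl v ∈ ((Finset.univ.image kl ∪ Finset.univ.image kr : Finset _) : Set _) :=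
    fun v => by simp
  have hkr : ∀ v, kr v ∈ ((Finset.univ.image kl ∪ Finset.univ.image kr : Finset _) : Set _) :=
    fun v => by simp
  have hne : ∀ u v, kl u ≠ kr v := fun u v h => by
    have := congrArg (fun k => (ofLex (ofLex k).2).1) h
    simp [kl, kr] at this
  refine ⟨fun v => ρ (kl v), fun v => ρ (kr v), fun v => ⟨(hunit _).1, ?_, (hunit _).2⟩,
    fun u v huv => ⟨?_, ?_, ?_, ?_⟩, fun u v huv => ?_⟩
  · exact hρ (hkl v) (hkr v) ((hlr v v).2 (hlt v).le)
  · refine hρ.injOn.ne (hkl u) (hkl v) fun h => huv (hidx ?_)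
    exact congrArg (fun k => (ofLex (ofLex (ofLex k).2).2).2) h
  · exact hρ.injOn.ne (hkl u) (hkr v) (hne u v)
  · exact hρ.injOn.ne (hkr u) (hkl v) (hne v u).symm
  · refine hρ.injOn.ne (hkr u) (hkr v) fun h => huv (hidx ?_)
    exact congrArg (fun k => (ofLex (ofLex (ofLex k).2).2).2) h
  · rw [overlap_iff]
    simp only [hρ.lt_iff_lt (hkl _) (hkl _), hρ.lt_iff_lt (hkl _) (hkr _),
      hρ.lt_iff_lt (hkr _) (hkr _), hll, hrr, hlr]
    have hidxne : idx u ≠ idx v := hidx.ne huv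
    constructor
    · rintro (⟨h1, h2, h3⟩ | ⟨h1, h2, h3⟩)
      · exact Or.inl ⟨h1.elim le_of_lt fun h => h.1.le, h2, h3.elim le_of_lt fun h => h.1.le⟩
      · exact Or.inr ⟨h1.elim le_of_lt fun h => h.1.le, h2, h3.elim le_of_lt fun h => h.1.le⟩
    · have key : ∀ u v, (lo u ≤ lo v ∧ lo v ≤ hi u ∧ hi u ≤ hi v) →
          (lo u = lo v → hi u = hi v → idx u < idx v) →
          (lo u < lo v ∨ lo u = lo v ∧ (hi u < hi v ∨ hi u = hi v ∧ idx u < idx v)) ∧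
            lo v ≤ hi u ∧
            (hi u < hi v ∨ hi u = hi v ∧ (lo u < lo v ∨ lo u = lo v ∧ idx u < idx v)) := by
        rintro u v ⟨h1, h2, h3⟩ h
        rcases h1.lt_or_eq with h1 | h1 <;> rcases h3.lt_or_eq with h3 | h3
        · exact ⟨Or.inl h1, h2, Or.inl h3⟩
        · exact ⟨Or.inl h1, h2, Or.inr ⟨h3, Or.inl h1⟩⟩
        · exact ⟨Or.inr ⟨h1, Or.inl h3⟩, h2, Or.inl h3⟩
        · exact ⟨Or.inr ⟨h1, Or.inr ⟨h3, h h1 h3⟩⟩, h2, Or.inr ⟨h3, Or.inr ⟨h1, h h1 h3⟩⟩⟩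
      intro h
      by_cases heq : lo u = lo v ∧ hi u = hi v
      · rcases hidxne.lt_or_gt with hi' | hi'
        · exact Or.inl (key u v ⟨heq.1.le, heq.1 ▸ (hlt u).le, heq.2.le⟩ fun _ _ => hi')
        · exact Or.inr (key v u ⟨heq.1.ge, heq.1 ▸ (hlt v).le, heq.2.ge⟩ fun _ _ => hi')
      · rcases h with h | h
        · exact Or.inl (key u v h fun h1 h2 => absurd ⟨h1, h2⟩ heq)
        · exact Or.inr (key v u h fun h1 h2 => absurd ⟨h1.symm, h2.symm⟩ heq)

theorem IsCircleGraph.exists_intervalSystem {V : Type*} [Finite V] {G : SimpleGraph V}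
    (hG : IsCircleGraph G) : ∃ (ℐ : IntervalSystem) (φ : V → ℝ × ℝ), (∀ v, φ v ∈ ℐ.intervals) ∧
      (∀ I ∈ ℐ.intervals, ∃ v, φ v = I) ∧ ∀ u v, G.Adj u v ↔ Overlap (φ u) (φ v) := by
  classical
  have : Fintype V := Fintype.ofFinite V
  obtain ⟨lo, hi, hlt, hadj⟩ := hG.exists_angles
  obtain ⟨l, r, hunit, hne, hov⟩ := exists_distinct_endpoints hlt
  refine ⟨⟨Finset.univ.image fun v => (l v, r v), ?_, ?_⟩, fun v => (l v, r v), ?_, ?_, ?_⟩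
  · intro I hI
    obtain ⟨v, -, rfl⟩ := Finset.mem_image.1 hI
    exact hunit v
  · intro I hI J hJ hIJ
    obtain ⟨u, -, rfl⟩ := Finset.mem_image.1 hI
    obtain ⟨v, -, rfl⟩ := Finset.mem_image.1 hJ
    exact hne u v fun h => hIJ (by rw [h])
  · exact fun v => Finset.mem_image_of_mem _ (Finset.mem_univ v)
  · intro I hI
    obtain ⟨v, -, hv⟩ := Finset.mem_image.1 hI
    exact ⟨v, hv⟩
  · intro u v
    rcases eq_or_ne u v with rfl | huv
    · exact iff_of_false (G.irrefl) fun h => h.2.1 subset_rfl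
    · rw [hadj, hov u v huv]
      exact and_iff_right huv

/-! ### The colouring theorem -/

namespace PillarAssignment

variable {ℐ : IntervalSystem}

theorem exists_complete_extends {ω : ℕ} (hω : 2 ≤ ω)
    (hclique : (overlapGraph ℐ.intervals).cliqueNum ≤ ω) (P : PillarAssignment ℐ)
    (hχ : (P.χ : ℝ) ≤ colourBound ω)
    (hdeg : ∀ K : ℝ × ℝ, P.IsArch K → (P.degree K : ℝ) ≤ degreeBound ω) :
    ∃ P' : PillarAssignment ℐ, P'.IsComplete ∧ P'.Extends P ∧ (P'.χ : ℝ) ≤ colourBound ω := by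
  obtain ⟨n, t, hn, ht, htD, hDF, hcut⟩ := exists_parameters hω
  obtain ⟨P', hc, hsuf, hχ'⟩ := P.exists_complete hclique hn ht htD hDF hcut (Nat.le_floor hχ)
    fun K hK => Nat.le_floor (hdeg K hK)
  exact ⟨P', hc, extends_of_suffix hsuf, (Nat.le_floor_iff ((Nat.cast_nonneg _).trans hχ)).1 hχ'⟩

theorem exists_complete_χ_le {ω : ℕ} (hω : 2 ≤ ω)
    (hclique : (overlapGraph ℐ.intervals).cliqueNum ≤ ω) :
    ∃ P : PillarAssignment ℐ, P.IsComplete ∧ (P.χ : ℝ) ≤ colourBound ω := by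
  have hL := one_le_logb_two hω
  have hl0 := Real.logb_nonneg (b := 2) (by norm_num) hL
  obtain ⟨P, hc, -, hχ⟩ := exists_complete_extends (ℐ := ℐ) hω hclique ⟨[], by simp, by simp⟩
    (by
      have : (0 : ℝ) ≤ colourBound ω := by
        rw [colourBound]
        positivity
      simpa [χ, IntervalSystem.allColours] using this)
    (fun K _ => by
      have : (0 : ℝ) ≤ degreeBound ω := by
        rw [degreeBound]
        positivity
      refine le_trans (le_of_eq ?_) this
      rw [Nat.cast_eq_zero, degree, Finset.card_eq_zero, Finset.eq_empty_iff_forall_notMem]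
      simp [IntervalSystem.mem_receivedColours, ψ, IntervalSystem.colouring])
  exact ⟨P, hc, hχ⟩

end PillarAssignment

theorem IsCircleGraph.exists_colorable {V : Type*} [Finite V] {G : SimpleGraph V}
    (hG : IsCircleGraph G) {ω : ℕ} (hω : 2 ≤ ω) (hclique : G.cliqueNum ≤ ω) :
    ∃ k : ℕ, G.Colorable k ∧ (k : ℝ) ≤ colourBound ω := by
  obtain ⟨ℐ, φ, hφ, hsurj, hadj⟩ := hG.exists_intervalSystem
  choose g hg using fun I : ℐ.intervals => hsurj I.1 I.2
  have hov : (overlapGraph ℐ.intervals).cliqueNum ≤ ω := by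
    refine le_trans (SimpleGraph.cliqueNum_le_of_injective g
      (fun I J h => ?_) fun I J h => ?_) hclique
    · have h' := congrArg φ h
      rw [hg, hg] at h'
      exact Subtype.ext h'
    · rw [hadj, hg, hg]
      exact h
  obtain ⟨P, hc, hχ⟩ := PillarAssignment.exists_complete_χ_le hω hov
  refine ⟨P.χ, ?_, hχ⟩
  have hcol : ∀ v, ∃ c, P.ψ (φ v) = some c := fun v =>
    ℐ.exists_colouring_eq_some (hφ v) (hc _ (hφ v))
  choose c hcψ using hcol
  have hproper := ℐ.isProperPartialColouring_colouring P.pillars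
  let C : G.Coloring (ℐ.allColours P.pillars) := SimpleGraph.Coloring.mk
    (fun v => ⟨c v, ℐ.mem_allColours_of_colouring (hcψ v)⟩) fun {u v} huv heq => by
      refine hproper _ (hφ u) _ (hφ v) ((hadj u v).1 huv) _ (hcψ u) ?_
      rw [Subtype.mk.inj heq]
      exact hcψ v
  have := C.colorable
  rwa [Fintype.card_coe] at this

theorem theorem1 :
    (∀ (ω : ℕ), 2 ≤ ω → ∀ (V : Type*) [Finite V] (G : SimpleGraph V),
      IsCircleGraph G → G.cliqueNum ≤ ω →
        ∃ n : ℕ, G.chromaticNumber = (n : ℕ∞) ∧ (n : ℝ) ≤ colourBound ω) ∧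
    (colourBound =O[Filter.atTop] fun ω : ℕ => (ω : ℝ) * Real.logb 2 (ω : ℝ)) ∧
    (∀ (ω : ℕ), 2 ≤ ω → ∀ (ℐ : IntervalSystem), (overlapGraph ℐ.intervals).cliqueNum ≤ ω →
      ∀ (P : PillarAssignment ℐ), (P.χ : ℝ) ≤ colourBound ω →
        (∀ K : ℝ × ℝ, P.IsArch K → (P.degree K : ℝ) ≤ degreeBound ω) →
          ∃ P' : PillarAssignment ℐ,
            P'.IsComplete ∧ P'.Extends P ∧ (P'.χ : ℝ) ≤ colourBound ω) := by
  refine ⟨fun ω hω V _ G hG hclique => ?_, colourBound_isBigO, fun ω hω ℐ hclique P hχ hdeg =>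
    P.exists_complete_extends hω hclique hχ hdeg⟩
  obtain ⟨k, hk, hkω⟩ := hG.exists_colorable hω hclique
  obtain ⟨n, hn⟩ := ENat.ne_top_iff_exists.1
    (ne_top_of_le_ne_top (ENat.natCast_ne_top k) hk.chromaticNumber_le)
  refine ⟨n, hn.symm, le_trans ?_ hkω⟩
  have := hk.chromaticNumber_le
  rw [← hn] at this
  exact_mod_cast this
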